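/- Let $N\ge 2$, $\omega=e^{2\pi i/N}$, $n\ge 1$, and let $u,v,\varkappa,\theta\in\mathbb C\setminus\{0\}$, $\alpha_-,\eta_-\in\mathbb C$. On $\mathcal V=\mathcal V_1\otimes\cdots\otimes\mathcal V_n$, where each $\mathcal V_k$ has basis $|\gamma\rangle_k$, $\gamma\in\mathbb Z_N$, let $\boldsymbol v_k|\gamma\rangle_k=v\omega^\gamma|\gamma\rangle_k$ and $\boldsymbol u_k|\gamma\rangle_k=u|\gamma-1\rangle_k$, and put $$L_k(\lambda)=\begin{pmatrix}1+\frac{\varkappa}{\lambda}\boldsymbol v_k&-\frac1\lambda\boldsymbol u_k\\ \boldsymbol u_k^{-1}\boldsymbol v_k&0\end{pmatrix},\quad \widetilde L_k(\lambda)=\begin{pmatrix}\varkappa\lambda+\omega\theta\boldsymbol v_k^{-1}&-\theta\boldsymbol u_k^{-1}\\ \lambda\boldsymbol v_k^{-1}\boldsymbol u_k&0\end{pmatrix},\quad K_-(\lambda)=\begin{pmatrix}\alpha_-(\frac\theta\lambda-\lambda)&\eta_-\\ \eta_-&0\end{pmatrix}$$ (this is the boundary matrix with $\beta_-=\delta_-=0$).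 Let $\mathcal A(\lambda)$ be the upper left entry of $\widetilde L_n(\lambda)\cdots\widetilde L_1(\lambda)K_-(\lambda)L_1(\lambda)\cdots L_n(\lambda)$ and $\widetilde{\mathcal A}(\lambda)=\lambda\mathcal A(\lambda)/(\theta-\lambda^2)$. For a point $p=(x,y)$ with $x^N+y^N=1$ and $y\neq0$ (all points below are required to satisfy these two conditions) let $w_p:\mathbb Z_N\to\mathbb C$ be defined by $w_p(0)=1$, $w_p(s)/w_p(s-1)=y/(1-x\omega^s)$. *Open chain.* Let $v_{m,s}$ $(1\le s\le m\le n)$ be complex numbers and $p_{m,s;m',s'}=(v_{m,s}/v_{m',s'},\,y_{m,s;m',s'})$ points as above, for $m'=m$, $s\ne s'$ and for $m'=m+1$, such that $v_{1,1}=v$ and, for $2\le m\le n$ and $1\le l\le m-1$, $$\prod_{s=1}^m v_{m,s}=v\prod_{s=1}^{m-1}v_{m-1,s},\qquad \varkappa\prod_{s\ne l}\frac{y_{m-1,s;m-1,l}}{y_{m-1,l;m-1,s}}\cdot\frac{\prod_{k=1}^m y_{m-1,l;m,k}}{\prod_{s=1}^{m-2}y_{m-2,s;m-1,l}}=1 .$$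 Define $|\boldsymbol\gamma_m\rangle\in\mathcal V_1\otimes\cdots\otimes\mathcal V_m$, $\boldsymbol\gamma_m\in\mathbb Z_N^m$, by $|\boldsymbol\gamma_1\rangle=|\gamma_{1,1}\rangle_1$ and $$|\boldsymbol\gamma_m\rangle=\sum_{\boldsymbol\gamma_{m-1}\in\mathbb Z_N^{m-1}}\frac{\omega^{\sum_l\gamma_{m-1,l}}\prod_{j\ne l}w_{p_{m-1,j;m-1,l}}(\gamma_{m-1,j}-\gamma_{m-1,l}-1)}{\prod_{k=1}^m\prod_{l=1}^{m-1}w_{p_{m-1,l;m,k}}(\gamma_{m-1,l}-\gamma_{m,k}-1)}\,|\boldsymbol\gamma_{m-1}\rangle\otimes\Bigl|\sum_{k}\gamma_{m,k}-\sum_{l}\gamma_{m-1,l}\Bigr\rangle_m .$$ Put $h_r=u\prod_{l=1}^{n-1}y_{n-1,l;n,r}$. *Boundary data.* Let $s_1,\dots,s_n\in\mathbb C\setminus\{0\}$, and let $\tilde p_{r,r'}=\tilde p_{r',r}$ $(r\neq r')$, $p^{B}_{r,k}$, $\tilde p^{B}_{r,k}$ $(1\le r,r',k\le n)$ be points as above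 with $x$-coordinates $\tilde x_{r,r'}=\varkappa^2v_{n,r}v_{n,r'}/(\omega\theta)$, $x^B_{r,k}=v_{n,r}/s_k$, $\tilde x^B_{r,k}=\varkappa^2v_{n,r}s_k/(\omega\theta)$, whose $y$-coordinates satisfy $$\frac{\eta_-v_{n,r}^2}{\varkappa^{n-2}\omega^{n+1}\theta}\prod_{r'\ne r}\tilde y_{r,r'}=\alpha_-h_r\prod_{k=1}^n y^B_{r,k}\tilde y^B_{r,k},\qquad r=1,\dots,n.$$ For $\boldsymbol\sigma\in\mathbb Z_N^n$ let $\lambda_k=-\varkappa s_k\omega^{\sigma_k}$ and $\Psi_{\boldsymbol\sigma}=\sum_{\boldsymbol\gamma\in\mathbb Z_N^n}Q(\boldsymbol\gamma,\boldsymbol\sigma)|\boldsymbol\gamma\rangle$, where $$Q(\boldsymbol\gamma,\boldsymbol\sigma)=\prod_{r}\omega^{\gamma_r^2+\gamma_r}\prod_{k,r}w_{p^B_{r,k}}(\gamma_r-\sigma_k)\,w_{\tilde p^B_{r,k}}(\gamma_r+\sigma_k)\prod_{r<r'}\frac{v_{n,r}\omega^{\gamma_r}-v_{n,r'}\omega^{\gamma_{r'}}}{w_{\tilde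 p_{r,r'}}(\gamma_r+\gamma_{r'})}.$$ Then $\Psi_{\boldsymbol\sigma}\neq0$, and for all $\lambda\ne0$ with $\lambda^2\ne\theta$ $$\widetilde{\mathcal A}(\lambda)\Psi_{\boldsymbol\sigma}=\alpha_-(-\varkappa)^n\prod_{k=1}^n\frac{(\lambda-\lambda_k)(\omega\theta/\lambda-\lambda_k)}{\lambda_k}\;\Psi_{\boldsymbol\sigma}.$$ If moreover $\alpha_-\ne0$, there are unique operators $H^B_1,\dots,H^B_n$ on $\mathcal V$ (the one-boundary Hamiltonians) with $$\widetilde{\mathcal A}(\lambda)=\alpha_-\varkappa^n\bigl(z^n+z^{n-1}H^B_1+\cdots+zH^B_{n-1}+H^B_n\bigr),\quad z=\lambda+\omega\theta/\lambda,\qquad\text{for all }\lambda\ne0,\ \lambda^2\ne\theta,$$ and $\Psi_{\boldsymbol\sigma}$ is a common eigenvector of them: $H^B_j\Psi_{\boldsymbol\sigma}=(-1)^je_j(z_1,\dots,z_n)\Psi_{\boldsymbol\sigma}$, where $z_k=\lambda_k+\omega\theta/\lambda_k$ and $e_j$ is the $j$-th elementary symmetric polynomial. -/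

import Mathlib

namespace RTC

/-! ### Roots of unity and cyclic functions -/

/-- The root of unity `ω = exp(2πi/N)`. -/
noncomputable def omega (N : ℕ) : ℂ := Complex.exp (2 * Real.pi * Complex.I / N)

/-- `ω ^ a` for a residue class `a` modulo `N`. -/
noncomputable def omegaPow {N : ℕ} (a : ZMod N) : ℂ := omega N ^ a.val

/-- `p = (x, y)` lies on the Fermat curve `x ^ N + y ^ N = 1` and `y ≠ 0` (equivalently
`x ^ N ≠ 1`); these are the points for which the cyclic function `w_p` is defined, with finite
nonzero values. -/
def IsFermatPoint (N : ℕ) (p : ℂ × ℂ) : Prop := p.1 ^ N + p.2 ^ N = 1 ∧ p.2 ≠ 0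

/-- The cyclic function `w_p`, given by `w_p(0) = 1` and `w_p(s) / w_p(s-1) = y / (1 - x ω^s)`
(see `fermatW_zero` and `fermatW_step`). -/
noncomputable def fermatW {N : ℕ} (p : ℂ × ℂ) (s : ZMod N) : ℂ :=
  ∏ j ∈ Finset.range s.val, p.2 / (1 - p.1 * omega N ^ (j + 1))

theorem isPrimitiveRoot_omega (N : ℕ) [NeZero N] : IsPrimitiveRoot (omega N) N :=
  Complex.isPrimitiveRoot_exp N (NeZero.ne N)

theorem fermatW_zero {N : ℕ} [NeZero N] (p : ℂ × ℂ) : fermatW p (0 : ZMod N) = 1 := by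
  simp [fermatW]

theorem one_sub_ne_zero_of_isFermatPoint {N : ℕ} [NeZero N] {p : ℂ × ℂ} (hp : IsFermatPoint N p)
    (j : ℕ) : 1 - p.1 * omega N ^ j ≠ 0 := by
  intro h
  have h1 : p.1 * omega N ^ j = 1 := (sub_eq_zero.mp h).symm
  have h2 : p.1 ^ N = 1 := by
    have h3 : (p.1 * omega N ^ j) ^ N = 1 := by rw [h1, one_pow]
    rwa [mul_pow, ← pow_mul, mul_comm j N, pow_mul, (isPrimitiveRoot_omega N).pow_eq_one,
      one_pow, mul_one] at h3
  have h4 := hp.1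
  rw [h2] at h4
  have h5 : p.2 ^ N = 0 := by linear_combination h4
  exact hp.2 (eq_zero_of_pow_eq_zero h5)

theorem prod_one_sub_omega (N : ℕ) [NeZero N] (x : ℂ) :
    ∏ j ∈ Finset.range N, (1 - x * omega N ^ j) = 1 - x ^ N := by
  have hω := isPrimitiveRoot_omega N
  have hN := NeZero.pos N
  have himg : (Finset.range N).image (fun j => omega N ^ j)
      = Polynomial.nthRootsFinset N (1 : ℂ) := by
    apply Finset.eq_of_subset_of_card_le
    · intro z hz
      obtain ⟨j, _, rfl⟩ := Finset.mem_image.mp hz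
      rw [Polynomial.mem_nthRootsFinset hN, ← pow_mul, mul_comm, pow_mul, hω.pow_eq_one, one_pow]
    · rw [hω.card_nthRootsFinset, Finset.card_image_of_injOn, Finset.card_range]
      intro a ha b hb hab
      exact hω.pow_inj (Finset.mem_range.mp ha) (Finset.mem_range.mp hb) hab
  have h := hω.pow_sub_pow_eq_prod_sub_mul 1 x hN
  rw [one_pow, ← himg, Finset.prod_image] at h
  · rw [h]
    exact Finset.prod_congr rfl fun j _ => by rw [mul_comm]
  · intro a ha b hb hab
    exact hω.pow_inj (Finset.mem_range.mp ha) (Finset.mem_range.mp hb) hab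

theorem fermatW_ne_zero {N : ℕ} [NeZero N] {p : ℂ × ℂ} (hp : IsFermatPoint N p) (s : ZMod N) :
    fermatW p s ≠ 0 :=
  Finset.prod_ne_zero_iff.mpr fun j _ =>
    div_ne_zero hp.2 (one_sub_ne_zero_of_isFermatPoint hp (j + 1))

theorem fermatW_step {N : ℕ} [NeZero N] {p : ℂ × ℂ} (hp : IsFermatPoint N p) (s : ZMod N) :
    fermatW p s / fermatW p (s - 1) = p.2 / (1 - p.1 * omegaPow s) := by
  rw [div_eq_iff (fermatW_ne_zero hp _)]
  obtain ⟨M, rfl⟩ : ∃ M, N = M + 1 := ⟨N - 1, by have := NeZero.pos N; omega⟩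
  by_cases hs : s = 0
  · subst hs
    have hval : (0 - 1 : ZMod (M + 1)).val = M := by rw [zero_sub, ZMod.val_neg_one]
    have hfull := prod_one_sub_omega (M + 1) p.1
    rw [Finset.prod_range_succ', pow_zero, mul_one] at hfull
    have hy : 1 - p.1 ^ (M + 1) = p.2 ^ (M + 1) := by linear_combination -hp.1
    have h1 : (1 : ℂ) - p.1 ≠ 0 := by simpa using one_sub_ne_zero_of_isFermatPoint hp 0
    have h2 : ∏ j ∈ Finset.range M, (1 - p.1 * omega (M + 1) ^ (j + 1)) ≠ 0 :=
      Finset.prod_ne_zero_iff.mpr fun j _ => one_sub_ne_zero_of_isFermatPoint hp (j + 1)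
    rw [fermatW_zero]
    simp only [fermatW, hval, omegaPow, ZMod.val_zero, pow_zero, mul_one]
    rw [Finset.prod_div_distrib, Finset.prod_const, Finset.card_range]
    field_simp
    rw [mul_comm, hfull, hy, pow_succ, mul_comm]
  · have hpos : 0 < s.val := Nat.pos_of_ne_zero fun h => hs ((ZMod.val_eq_zero s).mp h)
    have hM : M ≠ 0 := by
      rintro rfl
      exact hs (Subsingleton.elim (α := ZMod 1) s 0)
    have h1 : (1 : ZMod (M + 1)).val = 1 := ZMod.val_one'' (by omega)
    have hval : s.val = (s - 1).val + 1 := by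
      rw [ZMod.val_sub (by rw [h1]; exact hpos), h1]; omega
    simp only [fermatW, omegaPow]
    rw [hval, Finset.prod_range_succ, mul_comm]

/-! ### Quantum space, local operators and the monodromy matrices -/

/-- The space of states `𝒱 = 𝒱₁ ⊗ ⋯ ⊗ 𝒱ₙ`, written in coordinates: the function `ψ` stands for
the vector `∑ ψ(γ₁,…,γₙ) |γ₁⟩₁ ⊗ ⋯ ⊗ |γₙ⟩ₙ`. -/
abbrev State (N n : ℕ) := (Fin n → ZMod N) → ℂ

/-- The parameters: `u`, `v`, `ϰ` of the homogeneous chain, the reflection parameter `θ`, and the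
parameters `α₋`, `β₋`, `δ₋`, `η₋` of the boundary matrix `K₋`. -/
structure Params where
  u : ℂ
  v : ℂ
  kappa : ℂ
  theta : ℂ
  alpha : ℂ
  beta : ℂ
  delta : ℂ
  eta : ℂ

section Operators

variable {N n : ℕ} (P : Params)

/-- The operator multiplying the basis vector `|γ⟩` by `f γ`. -/
def diagOp (f : (Fin n → ZMod N) → ℂ) : Module.End ℂ (State N n) :=
  LinearMap.pi fun γ => f γ • LinearMap.proj γ

/-- The operator `|γ⟩ ↦ |γ - e⟩`. -/
def shiftOp (e : Fin n → ZMod N) : Module.End ℂ (State N n) :=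
  LinearMap.funLeft ℂ ℂ fun γ => γ + e

/-- `𝒗ₖ |γ⟩ₖ = v ω^γ |γ⟩ₖ`. -/
noncomputable def opV (k : Fin n) : Module.End ℂ (State N n) :=
  diagOp fun γ => P.v * omegaPow (γ k)

/-- `𝒗ₖ⁻¹`. -/
noncomputable def opVinv (k : Fin n) : Module.End ℂ (State N n) :=
  diagOp fun γ => (P.v * omegaPow (γ k))⁻¹

/-- `𝒖ₖ |γ⟩ₖ = u |γ-1⟩ₖ`. -/
def opU (k : Fin n) : Module.End ℂ (State N n) :=
  P.u • shiftOp (Pi.single k 1)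

/-- `𝒖ₖ⁻¹`. -/
noncomputable def opUinv (k : Fin n) : Module.End ℂ (State N n) :=
  P.u⁻¹ • shiftOp (-Pi.single k 1)

theorem opV_single (k : Fin n) (γ : Fin n → ZMod N) :
    opV P k (Pi.single γ 1) = (P.v * omegaPow (γ k)) • (Pi.single γ 1 : State N n) := by
  ext γ'
  by_cases h : γ' = γ
  · subst h; simp [opV, diagOp]
  · simp [opV, diagOp, h]

theorem opU_single (k : Fin n) (γ : Fin n → ZMod N) :
    opU P k (Pi.single γ 1) = P.u • (Pi.single (γ - Pi.single k 1) 1 : State N n) := by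
  ext γ'
  by_cases h : γ' = γ - Pi.single k 1
  · subst h; simp [opU, shiftOp]
  · have h' : γ' + Pi.single k 1 ≠ γ := fun e => h (eq_sub_of_add_eq e)
    simp [opU, shiftOp, h, h']

theorem opV_mul_opVinv (hv : P.v ≠ 0) (k : Fin n) :
    opV P k * opVinv P k = (1 : Module.End ℂ (State N n)) := by
  refine LinearMap.ext fun ψ => funext fun γ => ?_
  have h : P.v * omegaPow (γ k) ≠ 0 := mul_ne_zero hv (pow_ne_zero _ (Complex.exp_ne_zero _))
  simp only [opV, opVinv, diagOp, Module.End.mul_apply, LinearMap.pi_apply, LinearMap.smul_apply,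
    LinearMap.proj_apply, smul_eq_mul, Module.End.one_apply]
  rw [mul_inv_cancel_left₀ h]

theorem opU_mul_opUinv (hu : P.u ≠ 0) (k : Fin n) :
    opU P k * opUinv P k = (1 : Module.End ℂ (State N n)) := by
  refine LinearMap.ext fun ψ => funext fun γ => ?_
  simp [opU, opUinv, shiftOp, hu]

/-- The `L`-operator `L_k(λ)`. -/
noncomputable def opL (k : Fin n) (lam : ℂ) : Matrix (Fin 2) (Fin 2) (Module.End ℂ (State N n)) :=
  !![1 + (P.kappa / lam) • opV P k, -((1 / lam) • opU P k);
     opUinv P k * opV P k, 0]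

/-- The twisted `L`-operator `L̃_k(λ)`. -/
noncomputable def opLt (k : Fin n) (lam : ℂ) :
    Matrix (Fin 2) (Fin 2) (Module.End ℂ (State N n)) :=
  !![(P.kappa * lam) • 1 + (omega N * P.theta) • opVinv P k, -(P.theta • opUinv P k);
     lam • (opVinv P k * opU P k), 0]

/-- The boundary matrix `K₋(λ)`. -/
noncomputable def matK (lam : ℂ) : Matrix (Fin 2) (Fin 2) ℂ :=
  !![P.alpha * (P.theta / lam - lam), P.eta + P.beta * (P.theta / lam);
     P.eta + P.beta * lam, P.delta * (P.theta / lam - lam)]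

/-- `U(λ) = L̃ₙ(λ) ⋯ L̃₁(λ) K₋(λ) L₁(λ) ⋯ Lₙ(λ)`. -/
noncomputable def matU (N n : ℕ) (lam : ℂ) :
    Matrix (Fin 2) (Fin 2) (Module.End ℂ (State N n)) :=
  (List.ofFn fun k : Fin n => opLt P k lam).reverse.prod
    * (matK P lam).map (algebraMap ℂ (Module.End ℂ (State N n)))
    * (List.ofFn fun k : Fin n => opL P k lam).prod

/-- `Ã(λ) = λ 𝒜(λ) / (θ - λ²)`, where `𝒜(λ)` is the upper left entry of `U(λ)`. -/
noncomputable def opAt (N n : ℕ) (lam : ℂ) : Module.End ℂ (State N n) :=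
  (lam / (P.theta - lam ^ 2)) • matU P N n lam 0 0

/-- `H` is the family `H₁ᴮ, …, Hₙᴮ` (`H j` being `H_{j+1}ᴮ`) of one-boundary Hamiltonians:
`Ã(λ) = α₋ ϰⁿ (zⁿ + zⁿ⁻¹ H₁ᴮ + ⋯ + z Hₙ₋₁ᴮ + Hₙᴮ)`, `z = λ + ωθ/λ`, for all `λ` for which `Ã(λ)`
is defined. -/
def IsHamiltonians (N n : ℕ) (H : Fin n → Module.End ℂ (State N n)) : Prop :=
  ∀ lam : ℂ, lam ≠ 0 → lam ^ 2 ≠ P.theta →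
    opAt P N n lam = (P.alpha * P.kappa ^ n) •
      ((lam + omega N * P.theta / lam) ^ n • (1 : Module.End ℂ (State N n))
        + ∑ j : Fin n, (lam + omega N * P.theta / lam) ^ (n - 1 - (j : ℕ)) • H j)

end Operators

/-! ### Eigenvectors of the open chain -/

section OpenChain

variable {N : ℕ} [NeZero N] (P : Params)
  (V : (m : ℕ) → Fin m → ℂ) (Y : (m : ℕ) → Fin m → (m' : ℕ) → Fin m' → ℂ)

/-- The point `p_{m,s;m',s'}`, with `x`-coordinate `v_{m,s} / v_{m',s'}` and `y`-coordinate
`y_{m,s;m',s'}`. -/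
noncomputable def openPoint (m : ℕ) (s : Fin m) (m' : ℕ) (s' : Fin m') : ℂ × ℂ :=
  (V m s / V m' s', Y m s m' s')

/-- The amplitudes `v_{m,s}` and the points `p_{m,s;m',s'}` used for the open chains with at most
`n` particles. In `amp_prod` the case `m = 0` reads `v_{1,1} = v`. -/
structure IsOpenData (N : ℕ) (P : Params) (n : ℕ)
    (V : (m : ℕ) → Fin m → ℂ) (Y : (m : ℕ) → Fin m → (m' : ℕ) → Fin m' → ℂ) : Prop where
  amp_prod : ∀ m : ℕ, m + 1 ≤ n → ∏ s, V (m + 1) s = (∏ s, V m s) * P.v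
  point_same : ∀ m : ℕ, m ≤ n → ∀ s s' : Fin m, s ≠ s' → IsFermatPoint N (openPoint V Y m s m s')
  point_step : ∀ m : ℕ, m + 1 ≤ n → ∀ (l : Fin m) (k : Fin (m + 1)),
    IsFermatPoint N (openPoint V Y m l (m + 1) k)
  amp_rec : ∀ m : ℕ, m + 1 ≤ n → ∀ l : Fin m,
    P.kappa * (∏ s ∈ Finset.univ.erase l, Y m s m l / Y m l m s)
      * ((∏ k : Fin (m + 1), Y m l (m + 1) k) / ∏ s : Fin (m - 1), Y (m - 1) s m l) = 1

/-- `μ(γ_m) = ∏_{j ≠ l} w_{p_{m,j;m,l}}(γ_{m,j} - γ_{m,l} - 1)`. -/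
noncomputable def mu (m : ℕ) (γ : Fin m → ZMod N) : ℂ :=
  ∏ j, ∏ l ∈ Finset.univ.erase j, fermatW (openPoint V Y m j m l) (γ j - γ l - 1)

/-- `Q(γ_m | γ_{m+1})`. -/
noncomputable def openQ (m : ℕ) (γ : Fin m → ZMod N) (γ' : Fin (m + 1) → ZMod N) : ℂ :=
  omegaPow (∑ l, γ l) /
    ∏ k : Fin (m + 1), ∏ l : Fin m, fermatW (openPoint V Y m l (m + 1) k) (γ l - γ' k - 1)

/-- `ψ ⊗ |a⟩_{m+1}`. -/
def tensorKet {m : ℕ} (ψ : State N m) (a : ZMod N) : State N (m + 1) :=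
  fun γ => if γ (Fin.last m) = a then ψ (Fin.init γ) else 0

/-- The eigenvectors `|γ_n⟩` of the open chain with `n` particles, obtained from those of the
chain with `n - 1` particles. The recursion is started at `n = 0`, where the space of states is
one-dimensional; its first step gives the basis vectors of `𝒱₁` (see `ket_one`). -/
noncomputable def ket : (m : ℕ) → (Fin m → ZMod N) → State N m
  | 0, _ => fun _ => 1
  | m + 1, γ => ∑ γ' : Fin m → ZMod N,
      (mu V Y m γ' * openQ V Y m γ' γ) • tensorKet (ket m γ') (∑ k, γ k - ∑ l, γ' l)

theorem ket_one (γ : Fin 1 → ZMod N) : ket V Y 1 γ = Pi.single γ 1 := by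
  ext γ'
  by_cases hγ : γ' 0 = γ 0
  · obtain rfl : γ' = γ := funext fun i => by rw [Subsingleton.elim i 0, hγ]
    simp [ket, mu, openQ, tensorKet, omegaPow]
  · have h : γ' ≠ γ := fun e => hγ (by rw [e])
    rw [Pi.single_eq_of_ne h]
    simp [ket, mu, openQ, tensorKet, omegaPow, hγ]

/-- `h_r = u ∏_{l=1}^{n-1} y_{n-1,l;n,r}`. -/
def hCoef (n : ℕ) (r : Fin n) : ℂ := P.u * ∏ l : Fin (n - 1), Y (n - 1) l n r

end OpenChain

/-! ### The vectors `Ψ_σ` -/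

section Boundary

variable {N : ℕ} [NeZero N] (P : Params) {n : ℕ}
  (V : (m : ℕ) → Fin m → ℂ) (Y : (m : ℕ) → Fin m → (m' : ℕ) → Fin m' → ℂ)
  (S : Fin n → ℂ) (Yt YB YBt : Fin n → Fin n → ℂ)

/-- The point `p̃_{r,r'}`, with `x`-coordinate `ϰ² v_{n,r} v_{n,r'} / (ωθ)`. -/
noncomputable def ptT (N : ℕ) (r r' : Fin n) : ℂ × ℂ :=
  (P.kappa ^ 2 * V n r * V n r' / (omega N * P.theta), Yt r r')

/-- The point `p^B_{r,k}`, with `x`-coordinate `v_{n,r} / s_k`. -/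
noncomputable def ptB (r k : Fin n) : ℂ × ℂ := (V n r / S k, YB r k)

/-- The point `p̃^B_{r,k}`, with `x`-coordinate `ϰ² v_{n,r} s_k / (ωθ)`. -/
noncomputable def ptBT (N : ℕ) (r k : Fin n) : ℂ × ℂ :=
  (P.kappa ^ 2 * V n r * S k / (omega N * P.theta), YBt r k)

/-- The amplitudes `s_k` and the points `p̃_{r,r'} = p̃_{r',r}` (`r ≠ r'`), `p^B_{r,k}`,
`p̃^B_{r,k}` of the boundary problem, subject to the constraints on the `y`-coordinates. -/
structure IsBoundaryData (N : ℕ) (P : Params) (n : ℕ)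
    (V : (m : ℕ) → Fin m → ℂ) (Y : (m : ℕ) → Fin m → (m' : ℕ) → Fin m' → ℂ)
    (S : Fin n → ℂ) (Yt YB YBt : Fin n → Fin n → ℂ) : Prop where
  s_ne_zero : ∀ k, S k ≠ 0
  pointT : ∀ r r', r ≠ r' → IsFermatPoint N (ptT P V Yt N r r')
  symmT : ∀ r r', r ≠ r' → Yt r r' = Yt r' r
  pointB : ∀ r k, IsFermatPoint N (ptB V S YB r k)
  pointBT : ∀ r k, IsFermatPoint N (ptBT P V S YBt N r k)
  constraint : ∀ r : Fin n,
    P.eta * V n r ^ 2 / (P.kappa ^ ((n : ℤ) - 2) * omega N ^ (n + 1) * P.theta)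
        * ∏ r' ∈ Finset.univ.erase r, Yt r r'
      = P.alpha * hCoef P Y n r * ∏ k : Fin n, YB r k * YBt r k

/-- The coefficients `Q(γ_n, σ)`. -/
noncomputable def bdryQ (γ σ : Fin n → ZMod N) : ℂ :=
  (∏ r, omegaPow (γ r ^ 2 + γ r))
    * (∏ k, ∏ r, fermatW (ptB V S YB r k) (γ r - σ k)
        * fermatW (ptBT P V S YBt N r k) (γ r + σ k))
    * ∏ r, ∏ r' ∈ Finset.univ.filter (fun r' => r < r'),
        (V n r * omegaPow (γ r) - V n r' * omegaPow (γ r'))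
          / fermatW (ptT P V Yt N r r') (γ r + γ r')

/-- `Ψ_σ = ∑_{γ_n} Q(γ_n, σ) |γ_n⟩`. -/
noncomputable def Psi (σ : Fin n → ZMod N) : State N n :=
  ∑ γ : Fin n → ZMod N, bdryQ P V S Yt YB YBt γ σ • ket V Y n γ

/-- `λ_k = -ϰ s_k ω^{σ_k}`. -/
noncomputable def lamK (σ : Fin n → ZMod N) (k : Fin n) : ℂ :=
  -P.kappa * S k * omegaPow (σ k)

end Boundary

end RTC

namespace RTC

/-! ### Powers of `ω` -/

section OmegaPow

variable {N : ℕ} [NeZero N]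

/-! The proof is a separation of variables. With x = 1/λ, let A, B, C, D be the entries of T(x) =
L₁⋯Lₙ, which are polynomial in x, and put t_s = ϰ v_{n,s} ω^{γ_s}. On |γ⟩ the operator A(x) is
diagonal with eigenvalue ∏(1 + t_s x), and B(x) lowers one γ_r at a time (`monodromy_ket`). Both
facts come from one induction on the number of sites: comparing coefficients leaves identities
between polynomials in x, which are Lagrange interpolation at the zeros -1/t_r, and the step
relation of the functions w converts the interpolation values into shifts of γ. The quantum
determinant then gives C at each node -1/t_r, and deg C < n recovers C(x) for all x: it raises one
γ_r at a time (`monodromy_one_zero_ket`).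

The reflected monodromy matrix is, up to the factor (ωθ)ⁿ(𝒗₁⋯𝒗ₙ)⁻¹ and signs off the diagonal, the
transpose of T at x = λ/(ωθ) (`monodromyTilde_eq`). As β₋ = δ₋ = 0, the upper left entry of U(λ)
contains A and C only. So Ã(λ)|γ⟩ is a diagonal term plus terms with one γ_r raised (`opAt_ket`); in
z = λ + ωθ/λ the former is α₋ϰⁿ∏(z - ζ_s) with ζ_s = -t_s - ωθ/t_s, and the r-th of the latter is a
constant times ∏_{s≠r}(z - ζ_s).

Comparing coefficients of |γ⟩, the eigenvalue equation for Ψ_σ becomes the Lagrange interpolation of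
∏(z - z_k) - ∏(z - ζ_s) at the points ζ_r, as soon as Q(γ, σ) obeys a first-order recursion in each
γ_r. The factors of ζ_r - z_k and ζ_r - ζ_s are those in the step relations of the w's in Q, and the
constraint on the y-coordinates matches the remaining constant (`bdryQ_mul_raiseCoef`).

For a suitable x the eigenvalues of A(x) on the |γ⟩ are distinct, so these vectors form a basis;
since every Q(γ, σ) is nonzero, so is Ψ_σ. In this basis the Hamiltonians are read off as
coefficients of powers of z, and they are unique because z takes enough values. -/

theorem omega_ne_zero (N : ℕ) : omega N ≠ 0 := Complex.exp_ne_zero _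

theorem omegaPow_ne_zero (a : ZMod N) : omegaPow a ≠ 0 := pow_ne_zero _ (omega_ne_zero N)

theorem omegaPow_natCast (k : ℕ) : omegaPow (k : ZMod N) = omega N ^ k := by
  rw [omegaPow, ZMod.val_natCast]
  conv_rhs => rw [← Nat.mod_add_div k N, pow_add, pow_mul, (isPrimitiveRoot_omega N).pow_eq_one,
    one_pow, mul_one]

theorem omegaPow_zero : omegaPow (0 : ZMod N) = 1 := by
  simpa using omegaPow_natCast (N := N) 0

theorem omegaPow_one : omegaPow (1 : ZMod N) = omega N := by
  simpa using omegaPow_natCast (N := N) 1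

theorem omegaPow_add (a b : ZMod N) : omegaPow (a + b) = omegaPow a * omegaPow b := by
  rw [← ZMod.natCast_zmod_val a, ← ZMod.natCast_zmod_val b, ← Nat.cast_add, omegaPow_natCast,
    omegaPow_natCast, omegaPow_natCast, pow_add]

theorem omegaPow_sub (a b : ZMod N) : omegaPow (a - b) = omegaPow a / omegaPow b := by
  rw [eq_div_iff (omegaPow_ne_zero b), ← omegaPow_add, sub_add_cancel]

theorem omegaPow_add_one (a : ZMod N) : omegaPow (a + 1) = omegaPow a * omega N := by
  rw [omegaPow_add, omegaPow_one]

theorem omegaPow_sub_one (a : ZMod N) : omegaPow (a - 1) = omegaPow a / omega N := by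
  rw [omegaPow_sub, omegaPow_one]

theorem omegaPow_sum {ι : Type*} (s : Finset ι) (f : ι → ZMod N) :
    omegaPow (∑ i ∈ s, f i) = ∏ i ∈ s, omegaPow (f i) := by
  classical
  induction s using Finset.induction_on with
  | empty => simp [omegaPow_zero]
  | insert a s ha ih => rw [Finset.sum_insert ha, Finset.prod_insert ha, omegaPow_add, ih]

theorem omegaPow_injective : Function.Injective (omegaPow (N := N)) := by
  intro a b h
  exact ZMod.val_injective N
    ((isPrimitiveRoot_omega N).pow_inj (ZMod.val_lt a) (ZMod.val_lt b) h)

theorem one_sub_omegaPow_ne_zero {p : ℂ × ℂ} (hp : IsFermatPoint N p) (s : ZMod N) :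
    1 - p.1 * omegaPow s ≠ 0 := one_sub_ne_zero_of_isFermatPoint hp s.val

theorem fermatW_eq {p : ℂ × ℂ} (hp : IsFermatPoint N p) (s : ZMod N) :
    fermatW p s = fermatW p (s - 1) * (p.2 / (1 - p.1 * omegaPow s)) := by
  rw [← fermatW_step hp, mul_div_cancel₀ _ (fermatW_ne_zero hp _)]

end OmegaPow

/-! ### Operators of the chain with one site less -/

section Lift

variable {N m : ℕ}

/-- `X ⊗ 1`, acting on the first `m` of `m + 1` sites. -/
def liftEnd : Module.End ℂ (State N m) →ₐ[ℂ] Module.End ℂ (State N (m + 1)) where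
  toFun X :=
    { toFun := fun ψ γ => X (fun γ' => ψ (Fin.snoc (α := fun _ => ZMod N) γ' (γ (Fin.last m))))
        (Fin.init γ)
      map_add' := fun ψ φ => funext fun γ => congrFun (X.map_add _ _) (Fin.init γ)
      map_smul' := fun c ψ => funext fun γ => congrFun (X.map_smul c _) (Fin.init γ) }
  map_one' := by
    refine LinearMap.ext fun ψ => funext fun γ => ?_
    simp [Fin.snoc_init_self]
  map_mul' X Z := by
    refine LinearMap.ext fun ψ => funext fun γ => ?_
    simp [Module.End.mul_apply]
  map_zero' := rfl
  map_add' X Z := rfl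
  commutes' c := by
    refine LinearMap.ext fun ψ => funext fun γ => ?_
    simp [Algebra.algebraMap_eq_smul_one, Fin.snoc_init_self]

theorem liftEnd_apply (X : Module.End ℂ (State N m)) (ψ : State N (m + 1))
    (γ : Fin (m + 1) → ZMod N) :
    liftEnd X ψ γ = X (fun γ' => ψ (Fin.snoc (α := fun _ => ZMod N) γ' (γ (Fin.last m))))
      (Fin.init γ) := rfl

@[simp]
theorem diagOp_apply {n : ℕ} (f : (Fin n → ZMod N) → ℂ) (ψ : State N n) (γ : Fin n → ZMod N) :
    diagOp f ψ γ = f γ * ψ γ := rfl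

@[simp]
theorem shiftOp_apply {n : ℕ} (e : Fin n → ZMod N) (ψ : State N n) (γ : Fin n → ZMod N) :
    shiftOp e ψ γ = ψ (γ + e) := rfl

theorem snoc_add_single_castSucc (γ : Fin m → ZMod N) (a c : ZMod N) (k : Fin m) :
    Fin.snoc (α := fun _ => ZMod N) (γ + Pi.single k c) a
      = Fin.snoc (α := fun _ => ZMod N) γ a + Pi.single k.castSucc c := by
  funext i
  refine Fin.lastCases ?_ (fun j => ?_) i
  · simp [Fin.ext_iff, (Fin.is_lt k).ne']
  · simp [Pi.single_apply]

theorem liftEnd_diagOp (f : (Fin m → ZMod N) → ℂ) :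
    liftEnd (diagOp f) = diagOp fun γ => f (Fin.init γ) := by
  refine LinearMap.ext fun ψ => funext fun γ => ?_
  simp [liftEnd_apply, Fin.snoc_init_self]

theorem liftEnd_shiftOp_single (k : Fin m) (c : ZMod N) :
    liftEnd (shiftOp (Pi.single k c)) = shiftOp (Pi.single k.castSucc c) := by
  refine LinearMap.ext fun ψ => funext fun γ => ?_
  simp [liftEnd_apply, snoc_add_single_castSucc, Fin.snoc_init_self]

theorem liftEnd_opV (P : Params) (k : Fin m) :
    liftEnd (opV (N := N) P k) = opV P k.castSucc := liftEnd_diagOp _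

theorem liftEnd_opVinv (P : Params) (k : Fin m) :
    liftEnd (opVinv (N := N) P k) = opVinv P k.castSucc := liftEnd_diagOp _

theorem liftEnd_opU (P : Params) (k : Fin m) :
    liftEnd (opU (N := N) P k) = opU P k.castSucc := by
  rw [opU, map_smul, liftEnd_shiftOp_single, opU]

theorem liftEnd_opUinv (P : Params) (k : Fin m) :
    liftEnd (opUinv (N := N) P k) = opUinv P k.castSucc := by
  rw [opUinv, map_smul, ← Pi.single_neg, liftEnd_shiftOp_single, opUinv, Pi.single_neg]

theorem commute_liftEnd_diagOp_last (X : Module.End ℂ (State N m)) (f : ZMod N → ℂ) :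
    Commute (liftEnd X) (diagOp fun γ : Fin (m + 1) → ZMod N => f (γ (Fin.last m))) := by
  refine LinearMap.ext fun ψ => funext fun γ => ?_
  simp only [Module.End.mul_apply, liftEnd_apply, diagOp_apply, Fin.snoc_last]
  exact congrFun (X.map_smul (f (γ (Fin.last m))) _) (Fin.init γ)

theorem commute_liftEnd_shiftOp_last (X : Module.End ℂ (State N m)) (c : ZMod N) :
    Commute (liftEnd X) (shiftOp (Pi.single (Fin.last m) c)) := by
  refine LinearMap.ext fun ψ => funext fun γ => ?_
  have h1 : Fin.init (γ + Pi.single (Fin.last m) c) = Fin.init γ := by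
    funext i
    simp [Fin.init, Fin.ext_iff, (Fin.is_lt i).ne]
  have h2 (γ' : Fin m → ZMod N) (a : ZMod N) :
      Fin.snoc (α := fun _ => ZMod N) γ' a + Pi.single (Fin.last m) c
        = Fin.snoc (α := fun _ => ZMod N) γ' (a + c) := by
    funext i
    refine Fin.lastCases ?_ (fun j => ?_) i
    · simp
    · simp [Fin.ext_iff, (Fin.is_lt j).ne]
  simp only [Module.End.mul_apply, liftEnd_apply, shiftOp_apply, h1, h2, Pi.add_apply,
    Pi.single_eq_same]

variable (P : Params) (X : Module.End ℂ (State N m))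

theorem commute_liftEnd_opV : Commute (liftEnd X) (opV P (Fin.last m)) :=
  commute_liftEnd_diagOp_last X fun a => P.v * omegaPow a

theorem commute_liftEnd_opVinv : Commute (liftEnd X) (opVinv P (Fin.last m)) :=
  commute_liftEnd_diagOp_last X fun a => (P.v * omegaPow a)⁻¹

theorem commute_liftEnd_opU : Commute (liftEnd X) (opU P (Fin.last m)) :=
  (commute_liftEnd_shiftOp_last X 1).smul_right _

theorem commute_liftEnd_opUinv : Commute (liftEnd X) (opUinv P (Fin.last m)) := by
  rw [opUinv, ← Pi.single_neg]
  exact (commute_liftEnd_shiftOp_last X (-1)).smul_right _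

theorem liftEnd_tensorKet (ψ : State N m) (a : ZMod N) :
    liftEnd X (tensorKet ψ a) = tensorKet (X ψ) a := by
  funext γ
  rw [liftEnd_apply]
  simp only [tensorKet, Fin.snoc_last, Fin.init_snoc]
  split_ifs with h
  · rfl
  · exact congrFun (X.map_zero) _

end Lift

/-! ### Local relations -/

section Local

variable {N n : ℕ} [NeZero N] (P : Params)

theorem opU_mul_opV (k : Fin n) :
    opU P k * opV P k = omega N • (opV P k * opU P k : Module.End ℂ (State N n)) := by
  refine LinearMap.ext fun ψ => funext fun γ => ?_
  simp [opU, opV, omegaPow_add_one]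
  ring

theorem opUinv_mul_opV_mul_opU (hu : P.u ≠ 0) (k : Fin n) :
    opUinv P k * opV P k * opU P k
      = (omega N)⁻¹ • (opV P k : Module.End ℂ (State N n)) := by
  refine LinearMap.ext fun ψ => funext fun γ => ?_
  have := omega_ne_zero N
  simp [opU, opUinv, opV, ← sub_eq_add_neg, omegaPow_sub_one]
  field_simp

theorem opVinv_mul_opUinv_mul_opV (hv : P.v ≠ 0) (k : Fin n) :
    opVinv P k * (opUinv P k * opV P k)
      = (omega N)⁻¹ • (opUinv P k : Module.End ℂ (State N n)) := by
  refine LinearMap.ext fun ψ => funext fun γ => ?_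
  have := omega_ne_zero N
  have := omegaPow_ne_zero (γ k)
  simp [opUinv, opV, opVinv, ← sub_eq_add_neg, omegaPow_sub_one]
  field_simp

theorem opVinv_mul_opV (hv : P.v ≠ 0) (k : Fin n) :
    opVinv P k * opV P k = (1 : Module.End ℂ (State N n)) := by
  refine LinearMap.ext fun ψ => funext fun γ => ?_
  have := omegaPow_ne_zero (γ k)
  simp [opV, opVinv]
  field_simp

end Local

/-! ### Monodromy matrices -/

theorem end_mul_neg {N n : ℕ} (X Z : Module.End ℂ (State N n)) : X * -Z = -(X * Z) := mul_neg X Z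

theorem end_neg_mul {N n : ℕ} (X Z : Module.End ℂ (State N n)) : -X * Z = -(X * Z) := neg_mul X Z

section Monodromy

variable {N : ℕ} (P : Params)

/-- The `L`-operator as a function of `x = 1 / λ`. -/
noncomputable def opLInv {n : ℕ} (k : Fin n) (x : ℂ) :
    Matrix (Fin 2) (Fin 2) (Module.End ℂ (State N n)) :=
  !![1 + (P.kappa * x) • opV P k, -(x • opU P k); opUinv P k * opV P k, 0]

/-- The monodromy matrix `L₁(λ) ⋯ Lₘ(λ)` as a function of `x = 1 / λ`. -/
noncomputable def monodromy (N m : ℕ) (x : ℂ) :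
    Matrix (Fin 2) (Fin 2) (Module.End ℂ (State N m)) :=
  (List.ofFn fun k : Fin m => opLInv P k x).prod

/-- The reflected monodromy matrix `L̃ₘ(λ) ⋯ L̃₁(λ)`. -/
noncomputable def monodromyTilde (N m : ℕ) (lam : ℂ) :
    Matrix (Fin 2) (Fin 2) (Module.End ℂ (State N m)) :=
  (List.ofFn fun k : Fin m => opLt P k lam).reverse.prod

theorem opL_eq_opLInv {n : ℕ} (k : Fin n) (lam : ℂ) :
    opL (N := N) P k lam = opLInv P k lam⁻¹ := by
  simp [opL, opLInv, div_eq_mul_inv]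

theorem monodromy_succ (m : ℕ) (x : ℂ) :
    monodromy P N (m + 1) x = (monodromy P N m x).map liftEnd * opLInv P (Fin.last m) x := by
  have h : (monodromy P N m x).map liftEnd
      = (List.ofFn fun k : Fin m => opLInv (N := N) P k.castSucc x).prod := by
    change (liftEnd (N := N) (m := m)).toRingHom.mapMatrix (monodromy P N m x) = _
    rw [monodromy, map_list_prod, List.map_ofFn]
    congr 2
    funext k
    ext i j : 1
    fin_cases i <;> fin_cases j <;>
      simp [opLInv, liftEnd_opV, liftEnd_opU, liftEnd_opUinv]
  rw [h, monodromy, List.ofFn_succ', List.concat_eq_append, List.prod_append, List.prod_singleton]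

theorem monodromyTilde_succ (m : ℕ) (lam : ℂ) :
    monodromyTilde P N (m + 1) lam
      = opLt P (Fin.last m) lam * (monodromyTilde P N m lam).map liftEnd := by
  have h : (monodromyTilde P N m lam).map liftEnd
      = (List.ofFn fun k : Fin m => opLt (N := N) P k.castSucc lam).reverse.prod := by
    change (liftEnd (N := N) (m := m)).toRingHom.mapMatrix (monodromyTilde P N m lam) = _
    rw [monodromyTilde, map_list_prod, List.map_reverse, List.map_ofFn]
    congr 3
    funext k
    ext i j : 1
    fin_cases i <;> fin_cases j <;>
      simp [opLt, liftEnd_opVinv, liftEnd_opU, liftEnd_opUinv]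
  rw [h, monodromyTilde, List.ofFn_succ', List.concat_eq_append, List.reverse_append,
    List.prod_append, List.reverse_singleton, List.prod_singleton]

theorem monodromy_zero (x : ℂ) : monodromy P N 0 x = 1 := rfl

theorem monodromyTilde_zero (lam : ℂ) : monodromyTilde P N 0 lam = 1 := rfl

variable (m : ℕ) (x : ℂ)

theorem monodromy_succ_zero_zero :
    monodromy P N (m + 1) x 0 0
      = liftEnd (monodromy P N m x 0 0) * (1 + (P.kappa * x) • opV P (Fin.last m))
        + liftEnd (monodromy P N m x 0 1) * (opUinv P (Fin.last m) * opV P (Fin.last m)) := by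
  simp [monodromy_succ, Matrix.mul_apply, Fin.sum_univ_two, opLInv]

theorem monodromy_succ_zero_one :
    monodromy P N (m + 1) x 0 1
      = -(x • (liftEnd (monodromy P N m x 0 0) * opU P (Fin.last m))) := by
  simp [monodromy_succ, Matrix.mul_apply, Fin.sum_univ_two, opLInv, end_mul_neg]

theorem monodromy_succ_one_zero :
    monodromy P N (m + 1) x 1 0
      = liftEnd (monodromy P N m x 1 0) * (1 + (P.kappa * x) • opV P (Fin.last m))
        + liftEnd (monodromy P N m x 1 1) * (opUinv P (Fin.last m) * opV P (Fin.last m)) := by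
  simp [monodromy_succ, Matrix.mul_apply, Fin.sum_univ_two, opLInv]

theorem monodromy_succ_one_one :
    monodromy P N (m + 1) x 1 1
      = -(x • (liftEnd (monodromy P N m x 1 0) * opU P (Fin.last m))) := by
  simp [monodromy_succ, Matrix.mul_apply, Fin.sum_univ_two, opLInv, end_mul_neg]

/-- `𝒗₁ ⋯ 𝒗ₘ`. -/
noncomputable def totV (N m : ℕ) : Module.End ℂ (State N m) :=
  diagOp fun γ => P.v ^ m * omegaPow (∑ k, γ k)

/-- `(𝒗₁ ⋯ 𝒗ₘ)⁻¹`. -/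
noncomputable def totVinv (N m : ℕ) : Module.End ℂ (State N m) :=
  diagOp fun γ => (P.v ^ m * omegaPow (∑ k, γ k))⁻¹

variable [NeZero N]

theorem totV_succ : totV P N (m + 1) = liftEnd (totV P N m) * opV P (Fin.last m) := by
  rw [totV, totV, liftEnd_diagOp]
  refine LinearMap.ext fun ψ => funext fun γ => ?_
  simp [opV, Fin.sum_univ_castSucc, Fin.init, omegaPow_add]
  ring

theorem totVinv_succ :
    totVinv P N (m + 1) = liftEnd (totVinv P N m) * opVinv P (Fin.last m) := by
  rw [totVinv, totVinv, liftEnd_diagOp]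
  refine LinearMap.ext fun ψ => funext fun γ => ?_
  simp [opVinv, Fin.sum_univ_castSucc, Fin.init, omegaPow_add]
  ring

/-- The quantum determinant of the monodromy matrix. -/
theorem monodromy_qdet (hu : P.u ≠ 0) :
    omega N • (monodromy P N m (omega N * x) 1 0 * monodromy P N m x 0 1)
      - monodromy P N m (omega N * x) 1 1 * monodromy P N m x 0 0 = -(x ^ m • totV P N m) := by
  have hω := omega_ne_zero N
  induction m with
  | zero =>
    simp only [monodromy_zero, Matrix.one_apply_eq, totV]
    refine LinearMap.ext fun ψ => funext fun γ => ?_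
    simp [omegaPow_zero]
  | succ m ih =>
    rw [monodromy_succ_zero_zero, monodromy_succ_zero_one, monodromy_succ_one_zero,
      monodromy_succ_one_one, totV_succ]
    generalize monodromy P N m (omega N * x) 1 0 = C at *
    generalize monodromy P N m (omega N * x) 1 1 = D at *
    generalize monodromy P N m x 0 0 = A at *
    generalize monodromy P N m x 0 1 = B at *
    have ih' := congrArg liftEnd ih
    simp only [map_sub, map_smul, map_neg, map_mul] at ih'
    have e1 := opU_mul_opV (N := N) P (Fin.last m)
    have e2 := opUinv_mul_opV_mul_opU (N := N) P hu (Fin.last m)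
    have e3 : opU P (Fin.last m) * (opUinv P (Fin.last m) * opV P (Fin.last m))
        = (opV P (Fin.last m) : Module.End ℂ (State N (m + 1))) := by
      rw [← mul_assoc, opU_mul_opUinv P hu, one_mul]
    have cV := commute_liftEnd_opV P A
    have cU := commute_liftEnd_opU P A
    have cUi := commute_liftEnd_opUinv P A
    have cUB := commute_liftEnd_opU P B
    generalize opV P (Fin.last m) = v at *
    generalize opU P (Fin.last m) = u at *
    generalize opUinv P (Fin.last m) = w at *
    generalize liftEnd C = c at *
    generalize liftEnd D = d at *
    generalize liftEnd A = a at *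
    generalize liftEnd B = b at *
    generalize liftEnd (totV P N m) = t at *
    -- The operators of the last site move to the right past the lifted ones; the order of c, d
    -- relative to a, b never changes. After that the two c a v u terms cancel because u v = ω v u,
    -- the two c a u terms cancel outright, and what remains is x times the induction hypothesis
    -- multiplied by v.
    have k1 : c * (v * (a * u)) = c * a * (v * u) := by
      rw [← mul_assoc v, ← cV.eq]; simp only [mul_assoc]
    have k2 : c * (u * (a * v)) = omega N • (c * a * (v * u)) := by
      rw [← mul_assoc u, ← cU.eq, mul_assoc a, e1]; simp only [mul_assoc, mul_smul_comm]
    have k3 : d * (w * (v * (a * u))) = (omega N)⁻¹ • (d * a * v) := by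
      rw [← mul_assoc v, ← cV.eq, mul_assoc, ← mul_assoc w, ← cUi.eq, mul_assoc, ← mul_assoc w,
        e2, mul_smul_comm, mul_smul_comm, mul_assoc]
    have k4 : c * (u * (b * (w * v))) = c * b * v := by
      rw [← mul_assoc u, ← cUB.eq, mul_assoc b, e3, mul_assoc]
    have k5 : c * (u * a) = c * (a * u) := by rw [cU.eq]
    have k6 : x ^ m • (t * v) = d * a * v - omega N • (c * b * v) := by
      have : x ^ m • t = d * a - omega N • (c * b) := by rw [← neg_eq_iff_eq_neg.mpr ih']; abel
      rw [← smul_mul_assoc, this, sub_mul, smul_mul_assoc]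
    rw [pow_succ', mul_smul x, k6]
    simp only [mul_add, add_mul, smul_mul_assoc, mul_smul_comm, mul_one, mul_assoc, end_neg_mul,
      end_mul_neg] at *
    rw [k1, k2, k3, k4, k5]
    match_scalars <;> field_simp <;> ring

/-- L̃ is itself ωθ 𝒗⁻¹ times the transpose of L at x = λ/(ωθ) with negated off-diagonal entries.
Operators at different sites commute, so the relation passes to the products taken in reversed
order. It reduces everything about L̃ₘ⋯L̃₁ to the action of T. -/
theorem monodromyTilde_eq (hv : P.v ≠ 0) (htheta : P.theta ≠ 0) (lam : ℂ) :
    monodromyTilde P N m lam 0 0 = (omega N * P.theta) ^ m •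
        (totVinv P N m * monodromy P N m (lam / (omega N * P.theta)) 0 0) ∧
    monodromyTilde P N m lam 0 1 = -((omega N * P.theta) ^ m •
        (totVinv P N m * monodromy P N m (lam / (omega N * P.theta)) 1 0)) ∧
    monodromyTilde P N m lam 1 0 = -((omega N * P.theta) ^ m •
        (totVinv P N m * monodromy P N m (lam / (omega N * P.theta)) 0 1)) ∧
    monodromyTilde P N m lam 1 1 = (omega N * P.theta) ^ m •
        (totVinv P N m * monodromy P N m (lam / (omega N * P.theta)) 1 1) := by
  have hω := omega_ne_zero N
  induction m with
  | zero =>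
    have h1 : totVinv P N 0 = 1 := by
      refine LinearMap.ext fun ψ => funext fun γ => ?_
      simp [totVinv, omegaPow_zero]
    simp [monodromy_zero, monodromyTilde_zero, h1]
  | succ m ih =>
    obtain ⟨h00, h01, h10, h11⟩ := ih
    rw [monodromy_succ_zero_zero, monodromy_succ_zero_one, monodromy_succ_one_zero,
      monodromy_succ_one_one, totVinv_succ]
    have hrow (j : Fin 2) : monodromyTilde P N (m + 1) lam 0 j
        = ((P.kappa * lam) • 1 + (omega N * P.theta) • opVinv P (Fin.last m))
            * liftEnd (monodromyTilde P N m lam 0 j)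
          - (P.theta • opUinv P (Fin.last m)) * liftEnd (monodromyTilde P N m lam 1 j) := by
      simp [monodromyTilde_succ, Matrix.mul_apply, Fin.sum_univ_two, opLt, sub_eq_add_neg, end_neg_mul]
    have hrow' (j : Fin 2) : monodromyTilde P N (m + 1) lam 1 j
        = (lam • (opVinv P (Fin.last m) * opU P (Fin.last m)))
            * liftEnd (monodromyTilde P N m lam 0 j) := by
      simp [monodromyTilde_succ, Matrix.mul_apply, Fin.sum_univ_two, opLt]
    have e1 := opVinv_mul_opUinv_mul_opV (N := N) P hv (Fin.last m)
    have e2 := opVinv_mul_opV (N := N) P hv (Fin.last m)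
    have key (X Z : Module.End ℂ (State N m)) :
        ((P.kappa * lam) • 1 + (omega N * P.theta) • opVinv P (Fin.last m))
            * liftEnd ((omega N * P.theta) ^ m • (totVinv P N m * X))
          + (P.theta • opUinv P (Fin.last m))
            * liftEnd ((omega N * P.theta) ^ m • (totVinv P N m * Z))
        = (omega N * P.theta) ^ (m + 1) • (liftEnd (totVinv P N m) * opVinv P (Fin.last m)
          * (liftEnd X * (1 + (P.kappa * (lam / (omega N * P.theta))) • opV P (Fin.last m))
            + liftEnd Z * (opUinv P (Fin.last m) * opV P (Fin.last m)))) := by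
      -- The factor ω⁻¹ from reordering 𝒗⁻¹𝒖⁻¹𝒗 turns ωθ into the bare θ in front of 𝒖⁻¹ in L̃.
      have c1 := commute_liftEnd_opVinv P (totVinv P N m * X)
      have c2 := commute_liftEnd_opUinv P (totVinv P N m * Z)
      have c3 := commute_liftEnd_opVinv P X
      have c4 := commute_liftEnd_opVinv P Z
      simp only [map_smul, map_mul] at *
      generalize opV P (Fin.last m) = v at *
      generalize opVinv P (Fin.last m) = v' at *
      generalize opUinv P (Fin.last m) = w at *
      generalize liftEnd X = X at *
      generalize liftEnd Z = Z at *
      generalize liftEnd (totVinv P N m) = t at *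
      have k1 : v' * (t * X) = t * (X * v') := by rw [← c1.eq, mul_assoc]
      have k2 : w * (t * Z) = t * (Z * w) := by rw [← c2.eq, mul_assoc]
      have k3 : t * (v' * X) = t * (X * v') := by rw [c3.eq]
      have k4 : t * (v' * (X * v)) = t * X := by
        rw [← mul_assoc v', ← c3.eq, mul_assoc X, e2, mul_one]
      have k5 : t * (v' * (Z * (w * v))) = (omega N)⁻¹ • (t * (Z * w)) := by
        rw [← mul_assoc v', ← c4.eq, mul_assoc Z, e1, mul_smul_comm, mul_smul_comm]
      simp only [mul_add, add_mul, smul_mul_assoc, mul_smul_comm, mul_one, one_mul, mul_assoc]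
      rw [k1, k2, k3, k4, k5]
      match_scalars <;> field_simp <;> ring
    have key' (X : Module.End ℂ (State N m)) :
        (lam • (opVinv P (Fin.last m) * opU P (Fin.last m)))
            * liftEnd ((omega N * P.theta) ^ m • (totVinv P N m * X))
        = (omega N * P.theta) ^ (m + 1) • (liftEnd (totVinv P N m) * opVinv P (Fin.last m)
          * ((lam / (omega N * P.theta)) • (liftEnd X * opU P (Fin.last m)))) := by
      have c1 := commute_liftEnd_opVinv P (totVinv P N m * X)
      have c2 := commute_liftEnd_opU P (totVinv P N m * X)
      have c3 := commute_liftEnd_opVinv P X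
      simp only [map_smul, map_mul] at *
      generalize opVinv P (Fin.last m) = v' at *
      generalize opU P (Fin.last m) = w at *
      generalize liftEnd X = X at *
      generalize liftEnd (totVinv P N m) = t at *
      have k1 : v' * (w * (t * X)) = t * (X * (v' * w)) := by
        rw [← c2.eq, ← mul_assoc, ← c1.eq]; simp only [mul_assoc]
      have k2 : t * (v' * (X * w)) = t * (X * (v' * w)) := by
        rw [← mul_assoc v', ← c3.eq, mul_assoc]
      simp only [smul_mul_assoc, mul_smul_comm, mul_assoc]
      rw [k1, k2]
      match_scalars
      field_simp
      ring
    refine ⟨?_, ?_, ?_, ?_⟩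
    · rw [hrow, h00, h10, ← key]
      simp only [map_neg, end_mul_neg, sub_neg_eq_add]
    · rw [hrow, h01, h11, ← key]
      simp only [map_neg, end_mul_neg]
      abel
    · rw [hrow', h00, key', end_mul_neg, smul_neg, neg_neg]
    · rw [hrow', h01, map_neg, end_mul_neg, key', end_mul_neg, smul_neg]

end Monodromy

/-! ### Polynomial families of operators -/

section PolyFamily

variable {N : ℕ}

open Polynomial in
/-- The matrix elements of `F x` are polynomials in `x` of degree less than `d`. -/
def IsPolyFamily {n : ℕ} (d : ℕ) (F : ℂ → Module.End ℂ (State N n)) : Prop :=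
  ∀ ψ γ, ∃ p : ℂ[X], p.degree < d ∧ ∀ x, F x ψ γ = p.eval x

namespace IsPolyFamily

open Polynomial

variable {n d : ℕ} {F G : ℂ → Module.End ℂ (State N n)}

theorem mono (hF : IsPolyFamily d F) {d' : ℕ} (h : d ≤ d') : IsPolyFamily d' F := fun ψ γ => by
  obtain ⟨p, hp, he⟩ := hF ψ γ
  exact ⟨p, hp.trans_le (by exact_mod_cast h), he⟩

theorem add (hF : IsPolyFamily d F) (hG : IsPolyFamily d G) :
    IsPolyFamily d fun x => F x + G x := fun ψ γ => by
  obtain ⟨p, hp, he⟩ := hF ψ γ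
  obtain ⟨q, hq, he'⟩ := hG ψ γ
  exact ⟨p + q, (degree_add_le _ _).trans_lt (max_lt hp hq), fun x => by simp [he, he']⟩

theorem const_smul (hF : IsPolyFamily d F) (c : ℂ) : IsPolyFamily d fun x => c • F x :=
  fun ψ γ => by
    obtain ⟨p, hp, he⟩ := hF ψ γ
    refine ⟨C c * p, lt_of_le_of_lt ?_ hp, fun x => by simp [he]⟩
    rw [← smul_eq_C_mul]
    exact degree_smul_le c p

theorem neg (hF : IsPolyFamily d F) : IsPolyFamily d fun x => -F x := fun ψ γ => by
  obtain ⟨p, hp, he⟩ := hF ψ γ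
  exact ⟨-p, by rwa [degree_neg], fun x => by simp [he]⟩

theorem mul_const (hF : IsPolyFamily d F) (Z : Module.End ℂ (State N n)) :
    IsPolyFamily d fun x => F x * Z := fun ψ γ => hF (Z ψ) γ

theorem var_smul (hF : IsPolyFamily d F) : IsPolyFamily (d + 1) fun x => x • F x :=
  fun ψ γ => by
    obtain ⟨p, hp, he⟩ := hF ψ γ
    refine ⟨X * p, ?_, fun x => by simp [he]⟩
    by_cases h0 : p = 0
    · simp only [h0, mul_zero, degree_zero]
      exact bot_lt_iff_ne_bot.mpr (by simp)
    · rw [degree_eq_natDegree h0, Nat.cast_lt] at hp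
      rw [X_mul, degree_mul_X, degree_eq_natDegree h0]
      exact_mod_cast Nat.succ_lt_succ hp

theorem liftEnd (hF : IsPolyFamily d F) : IsPolyFamily d fun x => RTC.liftEnd (F x) :=
  fun _ _ => hF _ _

end IsPolyFamily

/-- The bound deg C < m is what lets C be recovered from its values at m nodes; D is carried along
for the induction. The `max m 1` accounts for m = 0, where D = 1 has degree 0. -/
theorem isPolyFamily_monodromy (P : Params) (m : ℕ) :
    IsPolyFamily m (fun x => monodromy P N m x 1 0) ∧
    IsPolyFamily (max m 1) (fun x => monodromy P N m x 1 1) := by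
  induction m with
  | zero =>
    refine ⟨fun ψ γ => ⟨0, by simp, fun x => by simp [monodromy_zero]⟩,
      fun ψ γ => ⟨Polynomial.C (ψ γ), ?_, fun x => by simp [monodromy_zero]⟩⟩
    exact Polynomial.degree_C_le.trans_lt (by simp)
  | succ m ih =>
    obtain ⟨hC, hD⟩ := ih
    constructor
    · simp only [monodromy_succ_one_zero, mul_add, mul_one]
      refine ((hC.liftEnd.mono m.le_succ).add ?_).add
        ((hD.liftEnd.mul_const _).mono (show max m 1 ≤ m + 1 by omega))
      have h := ((hC.liftEnd.mul_const (opV P (Fin.last m))).var_smul).const_smul P.kappa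
      simpa only [mul_smul_comm, mul_smul] using h
    · simp only [monodromy_succ_one_one]
      exact (hC.liftEnd.mul_const _).var_smul.neg.mono (le_max_left _ _)

end PolyFamily

/-! ### Interpolation -/

section Interpolation

open Polynomial

variable {n : ℕ}

theorem eval_eq_sum_lagrange {t : Fin n → ℂ} (ht : Function.Injective t) {p : ℂ[X]}
    (hp : p.degree < n) (x : ℂ) :
    p.eval x = ∑ r, p.eval (t r) * ∏ s ∈ Finset.univ.erase r, ((x - t s) / (t r - t s)) := by
  have h := Lagrange.eq_interpolate (s := Finset.univ) (v := t) ht.injOn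
    (f := p) (by simpa using hp)
  conv_lhs => rw [h]
  rw [Lagrange.interpolate_apply, eval_finsetSum]
  refine Finset.sum_congr rfl fun r _ => ?_
  rw [eval_mul, eval_C, Lagrange.basis, eval_prod]
  congr 1
  refine Finset.prod_congr rfl fun s _ => ?_
  simp [Lagrange.basisDivisor, div_eq_inv_mul]

/-- The nodes -1/t_r are the zeros of the eigenvalue ∏(1 + t_s x) of A(x), so the Lagrange basis
appears in the form met in the actions of B and C. -/
theorem eval_eq_sum_lagrange_inv {t : Fin n → ℂ} (ht : Function.Injective t) (h0 : ∀ r, t r ≠ 0)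
    {p : ℂ[X]} (hp : p.degree < n) (x : ℂ) :
    p.eval x = ∑ r, p.eval (-(t r)⁻¹)
      * ((∏ s ∈ Finset.univ.erase r, (1 + t s * x))
        / ∏ s ∈ Finset.univ.erase r, (1 - t s / t r)) := by
  have hinj : Function.Injective fun r => -(t r)⁻¹ := fun a b hab =>
    ht (inv_injective (neg_injective hab))
  rw [eval_eq_sum_lagrange hinj hp]
  refine Finset.sum_congr rfl fun r _ => ?_
  rw [← Finset.prod_div_distrib]
  congr 1
  refine Finset.prod_congr rfl fun s _ => ?_
  have := h0 s
  have := h0 r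
  rw [show x - -(t s)⁻¹ = (1 + t s * x) / t s by field_simp; ring,
    show -(t r)⁻¹ - -(t s)⁻¹ = (1 - t s / t r) / t s by field_simp; ring,
    div_div_div_cancel_right₀ (h0 s)]

theorem degree_prod_one_add_lt (t : Fin n → ℂ) {k : ℕ} (hk : n < k) :
    (∏ l, (1 + C (t l) * X) : ℂ[X]).degree < k := by
  refine (degree_prod_le _ _).trans_lt ?_
  refine (Finset.sum_le_card_nsmul _ _ 1 fun l _ => ?_).trans_lt ?_
  · refine (degree_add_le _ _).trans (max_le ?_ (degree_C_mul_X_le _))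
    rw [degree_one]; decide
  · simpa using hk

/-- A polynomial of degree at most n is determined by its values at n + 1 nodes. This is the
coefficient identity behind the action of B. -/
theorem prod_one_add_eq_lagrange {t : Fin (n + 1) → ℂ} (ht : Function.Injective t)
    (h0 : ∀ r, t r ≠ 0) (t' : Fin n → ℂ) (x : ℂ) :
    ∏ l, (1 + t' l * x) = ∑ r, (∏ l, (1 - t' l / t r))
      * ((∏ s ∈ Finset.univ.erase r, (1 + t s * x))
        / ∏ s ∈ Finset.univ.erase r, (1 - t s / t r)) := by
  have h := eval_eq_sum_lagrange_inv ht h0 (degree_prod_one_add_lt t' n.lt_succ_self) x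
  simpa [eval_prod, ← sub_eq_add_neg, ← div_eq_mul_inv] using h

theorem coeff_prod_one_add (t : Fin n → ℂ) :
    (∏ l, (1 + C (t l) * X)).coeff n = ∏ l, t l := by
  have h := coeff_prod_of_natDegree_le (Finset.univ : Finset (Fin n))
    (fun l => 1 + C (t l) * X) 1 fun l _ => by
      refine (natDegree_add_le _ _).trans (max_le (by simp) ((natDegree_C_mul_le _ _).trans natDegree_X_le))
  simpa [coeff_one] using h

/-- The two products agree in their constant terms and, by `hτ`, in their coefficients of degree n +
1. Their difference is therefore x times a polynomial of degree below n, which n nodes determine.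
This is the coefficient identity behind the eigenvalue of A: the sum is what B contributes. -/
theorem prod_one_add_sub_eq_lagrange {t' : Fin n → ℂ} (ht : Function.Injective t')
    (h0 : ∀ r, t' r ≠ 0) (t : Fin (n + 1) → ℂ) (τ : ℂ) (hτ : ∏ k, t k = τ * ∏ l, t' l) (x : ℂ) :
    ∏ k, (1 + t k * x) = (1 + τ * x) * ∏ l, (1 + t' l * x)
      + x * ∑ r, (-t' r * ∏ k, (1 - t k / t' r))
        * ((∏ s ∈ Finset.univ.erase r, (1 + t' s * x))
          / ∏ s ∈ Finset.univ.erase r, (1 - t' s / t' r)) := by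
  -- Prepending τ to t' makes the subtracted term a product of n + 1 factors as well, so that
  -- `coeff_prod_one_add` computes both top coefficients.
  set f : ℂ[X] := ∏ k, (1 + C (t k) * X) - ∏ k, (1 + C ((Fin.cons τ t' : Fin (n + 1) → ℂ) k) * X)
    with hf
  have hf_eval (y : ℂ) : f.eval y
      = ∏ k, (1 + t k * y) - (1 + τ * y) * ∏ l, (1 + t' l * y) := by
    simp [hf, eval_prod, Fin.prod_univ_succ]
  have hdiv : f = X * f.divX := by
    have h1 : f.coeff 0 = 0 := by
      rw [coeff_zero_eq_eval_zero, hf_eval]; simp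
    conv_lhs => rw [← divX_mul_X_add f, h1, C_0, add_zero, mul_comm]
  have hdeg : f.divX.degree < n := by
    rw [degree_lt_iff_coeff_zero]
    intro k hk
    rw [coeff_divX]
    rcases hk.eq_or_lt with rfl | hk
    · rw [hf, coeff_sub, coeff_prod_one_add, coeff_prod_one_add, hτ]
      simp [Fin.prod_univ_succ]
    · rw [hf, coeff_sub, coeff_eq_zero_of_degree_lt, coeff_eq_zero_of_degree_lt, sub_zero]
      · exact degree_prod_one_add_lt _ (by omega)
      · exact degree_prod_one_add_lt _ (by omega)
  have hval (r : Fin n) : f.divX.eval (-(t' r)⁻¹) = -t' r * ∏ k, (1 - t k / t' r) := by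
    have h1 := hf_eval (-(t' r)⁻¹)
    have h2 : ∏ l, (1 + t' l * -(t' r)⁻¹) = 0 :=
      Finset.prod_eq_zero (Finset.mem_univ r) (by rw [mul_neg, mul_inv_cancel₀ (h0 r)]; ring)
    rw [h2, mul_zero, sub_zero, hdiv, eval_mul, eval_X] at h1
    have h3 : ∏ k, (1 - t k / t' r) = ∏ k, (1 + t k * -(t' r)⁻¹) :=
      Finset.prod_congr rfl fun k _ => by ring
    rw [h3, ← h1]
    have := h0 r
    field_simp
  have h := eval_eq_sum_lagrange_inv ht h0 hdeg x
  simp only [hval] at h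
  have h1 : f.eval x = x * f.divX.eval x := by
    conv_lhs => rw [hdiv, eval_mul, eval_X]
  rw [← h, ← h1, hf_eval]
  ring

theorem IsPolyFamily.apply_eq_sum {N : ℕ} {F : ℂ → Module.End ℂ (State N n)} {d : ℕ}
    (hF : IsPolyFamily d F) {t : Fin d → ℂ} (ht : Function.Injective t) (h0 : ∀ r, t r ≠ 0)
    (x : ℂ) (ψ : State N n) :
    F x ψ = ∑ r, ((∏ s ∈ Finset.univ.erase r, (1 + t s * x))
        / ∏ s ∈ Finset.univ.erase r, (1 - t s / t r)) • F (-(t r)⁻¹) ψ := by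
  funext γ
  obtain ⟨p, hp, he⟩ := hF ψ γ
  rw [he, eval_eq_sum_lagrange_inv ht h0 hp, Finset.sum_apply]
  refine Finset.sum_congr rfl fun r _ => ?_
  rw [Pi.smul_apply, he, smul_eq_mul, mul_comm]

end Interpolation

/-! ### Amplitudes of the open chain -/

section Amplitudes

variable {N : ℕ} [NeZero N] (P : Params)
  (V : (m : ℕ) → Fin m → ℂ) (Y : (m : ℕ) → Fin m → (m' : ℕ) → Fin m' → ℂ)

/-- `ϰ v_{m,r} ω^{γ_r}`. -/
noncomputable def ampl {m : ℕ} (γ : Fin m → ZMod N) (r : Fin m) : ℂ :=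
  P.kappa * V m r * omegaPow (γ r)

variable {m : ℕ}

theorem ampl_add_single_self (γ : Fin m → ZMod N) (r : Fin m) :
    ampl P V (γ + Pi.single r 1) r = ampl P V γ r * omega N := by
  simp [ampl, omegaPow_add_one, mul_assoc]

theorem ampl_add_single_of_ne (γ : Fin m → ZMod N) {r s : Fin m} (h : s ≠ r) (a : ZMod N) :
    ampl P V (γ + Pi.single r a) s = ampl P V γ s := by
  simp [ampl, h]

theorem ampl_sub_single_self (γ : Fin m → ZMod N) (r : Fin m) :
    ampl P V (γ - Pi.single r 1) r = ampl P V γ r / omega N := by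
  simp [ampl, omegaPow_sub_one, mul_div_assoc]

theorem ampl_sub_single_of_ne (γ : Fin m → ZMod N) {r s : Fin m} (h : s ≠ r) (a : ZMod N) :
    ampl P V (γ - Pi.single r a) s = ampl P V γ s := by
  simp [ampl, h]

theorem prod_ampl (γ : Fin m → ZMod N) :
    ∏ s, ampl P V γ s = P.kappa ^ m * (∏ s, V m s) * omegaPow (∑ s, γ s) := by
  simp [ampl, Finset.prod_mul_distrib, omegaPow_sum]

theorem sum_add_single (γ : Fin m → ZMod N) (r : Fin m) (a : ZMod N) :
    ∑ s, (γ + Pi.single r a : Fin m → ZMod N) s = ∑ s, γ s + a := by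
  simp [Finset.sum_add_distrib]

theorem sum_sub_single (γ : Fin m → ZMod N) (r : Fin m) (a : ZMod N) :
    ∑ s, (γ - Pi.single r a : Fin m → ZMod N) s = ∑ s, γ s - a := by
  simp [Finset.sum_sub_distrib]

theorem ampl_div {m' : ℕ} (hkappa : P.kappa ≠ 0) (γ : Fin m → ZMod N) (γ' : Fin m' → ZMod N)
    (s : Fin m) (s' : Fin m') :
    (openPoint V Y m s m' s').1 * omegaPow (γ s - γ' s') = ampl P V γ s / ampl P V γ' s' := by
  rw [omegaPow_sub, ampl, ampl, openPoint, mul_assoc, mul_assoc, mul_div_mul_left _ _ hkappa,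
    div_mul_div_comm]

variable {P V Y} {n : ℕ}

namespace IsOpenData

theorem prod_V (hopen : IsOpenData N P n V Y)
    (hm : m ≤ n) : ∏ s, V m s = P.v ^ m := by
  induction m with
  | zero => simp
  | succ m ih => rw [hopen.amp_prod m hm, ih (by omega), pow_succ]

theorem V_ne_zero (hopen : IsOpenData N P n V Y)
    (hv : P.v ≠ 0) (hm : m ≤ n) (s : Fin m) : V m s ≠ 0 := by
  have h := hopen.prod_V hm
  exact (Finset.prod_ne_zero_iff.mp (h ▸ pow_ne_zero m hv)) s (Finset.mem_univ s)

theorem ampl_ne_zero (hopen : IsOpenData N P n V Y)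
    (hv : P.v ≠ 0) (hkappa : P.kappa ≠ 0) (hm : m ≤ n) (γ : Fin m → ZMod N)
    (s : Fin m) : ampl P V γ s ≠ 0 :=
  mul_ne_zero (mul_ne_zero hkappa (hopen.V_ne_zero hv hm s)) (omegaPow_ne_zero _)

/-- A Fermat point with y ≠ 0 has xᴺ ≠ 1, so v_{m,s} and v_{m,s'} do not differ by any N-th root of
unity. Hence γ and γ' may be different here, which is needed after shifts. -/
theorem one_sub_ampl_div_ne_zero (hopen : IsOpenData N P n V Y)
    (hkappa : P.kappa ≠ 0) (hm : m ≤ n) (γ γ' : Fin m → ZMod N)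
    {s s' : Fin m} (h : s ≠ s') : 1 - ampl P V γ s / ampl P V γ' s' ≠ 0 := by
  rw [← ampl_div P V Y hkappa]
  exact one_sub_omegaPow_ne_zero (hopen.point_same m hm s s' h) _

theorem ampl_ne (hopen : IsOpenData N P n V Y)
    (hv : P.v ≠ 0) (hkappa : P.kappa ≠ 0) (hm : m ≤ n) (γ γ' : Fin m → ZMod N)
    {s s' : Fin m} (h : s ≠ s') : ampl P V γ s ≠ ampl P V γ' s' := by
  intro e
  refine hopen.one_sub_ampl_div_ne_zero hkappa hm γ γ' h ?_
  rw [e, div_self (hopen.ampl_ne_zero hv hkappa hm γ' s'), sub_self]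

theorem ampl_injective (hopen : IsOpenData N P n V Y)
    (hv : P.v ≠ 0) (hkappa : P.kappa ≠ 0) (hm : m ≤ n) (γ : Fin m → ZMod N) :
    Function.Injective (ampl P V γ) := fun s s' e => by
  by_contra h
  exact hopen.ampl_ne hv hkappa hm γ γ h e

theorem hCoef_ne_zero (hopen : IsOpenData N P n V Y)
    (hu : P.u ≠ 0) (hm : m ≤ n) (r : Fin m) : hCoef P Y m r ≠ 0 := by
  cases m with
  | zero => exact r.elim0
  | succ m =>
    exact mul_ne_zero hu (Finset.prod_ne_zero_iff.mpr fun l _ => (hopen.point_step m hm l r).2)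

theorem mu_ne_zero (hopen : IsOpenData N P n V Y)
    (hm : m ≤ n) (γ : Fin m → ZMod N) : mu V Y m γ ≠ 0 :=
  Finset.prod_ne_zero_iff.mpr fun j _ => Finset.prod_ne_zero_iff.mpr fun l hl =>
    fermatW_ne_zero (hopen.point_same m hm j l (Finset.ne_of_mem_erase hl).symm) _

theorem openQ_ne_zero (hopen : IsOpenData N P n V Y)
    (hm : m + 1 ≤ n) (γ : Fin m → ZMod N) (γ' : Fin (m + 1) → ZMod N) :
    openQ V Y m γ γ' ≠ 0 :=
  div_ne_zero (omegaPow_ne_zero _) (Finset.prod_ne_zero_iff.mpr fun k _ =>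
    Finset.prod_ne_zero_iff.mpr fun l _ => fermatW_ne_zero (hopen.point_step m hm l k) _)

/-- The dependence of `Q(γ'|γ)` on `γ`. -/
theorem openQ_sub_single (hopen : IsOpenData N P n V Y)
    (hkappa : P.kappa ≠ 0) (hm : m + 1 ≤ n)
    (γ' : Fin m → ZMod N) (γ : Fin (m + 1) → ZMod N) (r : Fin (m + 1)) :
    openQ V Y m γ' γ * ∏ l, (1 - ampl P V γ' l / ampl P V γ r)
      = openQ V Y m γ' (γ - Pi.single r 1) * ∏ l, Y m l (m + 1) r := by
  have key : (∏ k, ∏ l, fermatW (openPoint V Y m l (m + 1) k)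
        (γ' l - (γ - Pi.single r 1 : Fin (m + 1) → ZMod N) k - 1)) * ∏ l, (1 - ampl P V γ' l / ampl P V γ r)
      = (∏ k, ∏ l, fermatW (openPoint V Y m l (m + 1) k) (γ' l - γ k - 1))
        * ∏ l, Y m l (m + 1) r := by
    rw [← Finset.mul_prod_erase _ _ (Finset.mem_univ r),
      ← Finset.mul_prod_erase _ (fun k => ∏ l, fermatW (openPoint V Y m l (m + 1) k)
        (γ' l - γ k - 1)) (Finset.mem_univ r), mul_right_comm, mul_right_comm (∏ l, _) _ (∏ l, _),
      ← Finset.prod_mul_distrib, ← Finset.prod_mul_distrib]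
    congr 1
    · refine Finset.prod_congr rfl fun l _ => ?_
      have hp := hopen.point_step m hm l r
      have h1 := one_sub_omegaPow_ne_zero hp (γ' l - γ r)
      rw [Pi.sub_apply, Pi.single_eq_same, show γ' l - (γ r - 1) - 1 = γ' l - γ r by ring,
        fermatW_eq hp (γ' l - γ r), ← ampl_div P V Y hkappa, mul_assoc, div_mul_cancel₀ _ h1]
      rfl
    · refine Finset.prod_congr rfl fun k hk => ?_
      simp [Finset.ne_of_mem_erase hk]
  have h0 (γ : Fin (m + 1) → ZMod N) :
      ∏ k, ∏ l, fermatW (openPoint V Y m l (m + 1) k) (γ' l - γ k - 1) ≠ 0 :=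
    Finset.prod_ne_zero_iff.mpr fun k _ =>
      Finset.prod_ne_zero_iff.mpr fun l _ => fermatW_ne_zero (hopen.point_step m hm l k) _
  have h1 := h0 γ
  have h2 := h0 (γ - Pi.single r 1)
  rw [openQ, openQ]
  field_simp
  linear_combination omegaPow (∑ l, γ' l) * key

/-- The dependence of `Q(γ'|γ)` on `γ'`. -/
theorem openQ_add_single (hopen : IsOpenData N P n V Y)
    (hkappa : P.kappa ≠ 0) (hm : m + 1 ≤ n)
    (γ' : Fin m → ZMod N) (γ : Fin (m + 1) → ZMod N) (l : Fin m) :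
    openQ V Y m (γ' + Pi.single l 1) γ * ∏ k, Y m l (m + 1) k
      = openQ V Y m γ' γ * (omega N * ∏ k, (1 - ampl P V γ' l / ampl P V γ k)) := by
  have key : (∏ k, ∏ j, fermatW (openPoint V Y m j (m + 1) k)
        ((γ' + Pi.single l 1 : Fin m → ZMod N) j - γ k - 1)) * ∏ k, (1 - ampl P V γ' l / ampl P V γ k)
      = (∏ k, ∏ j, fermatW (openPoint V Y m j (m + 1) k) (γ' j - γ k - 1))
        * ∏ k, Y m l (m + 1) k := by
    rw [← Finset.prod_mul_distrib, ← Finset.prod_mul_distrib]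
    refine Finset.prod_congr rfl fun k _ => ?_
    rw [← Finset.mul_prod_erase _ _ (Finset.mem_univ l),
      ← Finset.mul_prod_erase _ (fun j => fermatW (openPoint V Y m j (m + 1) k)
        (γ' j - γ k - 1)) (Finset.mem_univ l), mul_right_comm, mul_right_comm _ _ (Y m l (m + 1) k)]
    congr 1
    · have hp := hopen.point_step m hm l k
      have h1 := one_sub_omegaPow_ne_zero hp (γ' l - γ k)
      rw [Pi.add_apply, Pi.single_eq_same, show γ' l + 1 - γ k - 1 = γ' l - γ k by ring,
        fermatW_eq hp (γ' l - γ k), ← ampl_div P V Y hkappa, mul_assoc, div_mul_cancel₀ _ h1]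
      rfl
    · refine Finset.prod_congr rfl fun j hj => ?_
      simp [Finset.ne_of_mem_erase hj]
  have h0 (γ' : Fin m → ZMod N) :
      ∏ k, ∏ l, fermatW (openPoint V Y m l (m + 1) k) (γ' l - γ k - 1) ≠ 0 :=
    Finset.prod_ne_zero_iff.mpr fun k _ =>
      Finset.prod_ne_zero_iff.mpr fun l _ => fermatW_ne_zero (hopen.point_step m hm l k) _
  have h1 := h0 γ'
  have h2 := h0 (γ' + Pi.single l 1)
  rw [openQ, openQ, sum_add_single, omegaPow_add_one]
  field_simp
  linear_combination -(omegaPow (∑ s, γ' s) * omega N) * key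

/-- The dependence of `μ(γ)` on `γ`. -/
theorem mu_add_single (hopen : IsOpenData N P n V Y)
    (hkappa : P.kappa ≠ 0) (hm : m ≤ n) (γ : Fin m → ZMod N) (l : Fin m) :
    mu V Y m (γ + Pi.single l 1)
        * ((∏ s ∈ Finset.univ.erase l, (1 - ampl P V γ l / ampl P V γ s))
          * ∏ s ∈ Finset.univ.erase l, Y m s m l)
      = mu V Y m γ * ((∏ s ∈ Finset.univ.erase l, Y m l m s)
          * ∏ s ∈ Finset.univ.erase l, (1 - ampl P V γ s / (ampl P V γ l * omega N))) := by
  -- Products over one row or one column of the index pairs are padded with ones to products over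
  -- all pairs j ≠ s, after which the claim is checked factor by factor.
  have e1 (f : Fin m → ℂ) : ∏ s ∈ Finset.univ.erase l, f s
      = ∏ j, ∏ s ∈ Finset.univ.erase j, if j = l then f s else 1 := by
    rw [eq_comm, Finset.prod_eq_single l (fun j _ hj => by simp [hj]) (by simp)]
    simp
  have e2 (f : Fin m → ℂ) : ∏ s ∈ Finset.univ.erase l, f s
      = ∏ j, ∏ s ∈ Finset.univ.erase j, if s = l then f j else 1 := by
    rw [← Finset.mul_prod_erase _ _ (Finset.mem_univ l)]
    rw [Finset.prod_eq_one (s := Finset.univ.erase l) (f := fun s => if s = l then f l else 1)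
      (fun s hs => by simp [Finset.ne_of_mem_erase hs]), one_mul]
    refine Finset.prod_congr rfl fun j hj => ?_
    rw [Finset.prod_ite_eq', if_pos]
    simpa using (Finset.ne_of_mem_erase hj).symm
  rw [e1 (fun s => 1 - _), e2 (fun s => Y m s m l), e1 (fun s => Y m l m s),
    e2 (fun s => 1 - _), mu, mu]
  simp only [← Finset.prod_mul_distrib]
  refine Finset.prod_congr rfl fun j _ => Finset.prod_congr rfl fun s hs => ?_
  have hjs : j ≠ s := (Finset.ne_of_mem_erase hs).symm
  have hp := hopen.point_same m hm j s hjs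
  by_cases hj : j = l
  · subst hj
    have h1 := one_sub_omegaPow_ne_zero hp (γ j - γ s)
    simp only [if_true, if_neg hjs.symm, Pi.add_apply, Pi.single_eq_same, mul_one,
      Pi.single_eq_of_ne hjs.symm, add_zero]
    rw [show γ j + 1 - γ s - 1 = γ j - γ s by ring,
      fermatW_eq hp (γ j - γ s), ← ampl_div P V Y hkappa, mul_assoc, div_mul_cancel₀ _ h1]
    rfl
  · by_cases hs' : s = l
    · subst hs'
      have h1 := one_sub_omegaPow_ne_zero hp (γ j - γ s - 1)
      simp only [if_true, if_neg hj, Pi.add_apply, Pi.single_eq_same, one_mul,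
        Pi.single_eq_of_ne hj, add_zero]
      rw [fermatW_eq hp (γ j - γ s - 1), ← ampl_add_single_self P V γ s,
        ← ampl_div P V Y hkappa, Pi.add_apply, Pi.single_eq_same, mul_assoc,
        show γ j - (γ s + 1) = γ j - γ s - 1 by ring, div_mul_cancel₀ _ h1,
        show γ j - γ s - 1 - 1 = γ j - (γ s + 1) - 1 by ring]
      rfl
    · simp [hj, hs']

end IsOpenData

end Amplitudes

/-! ### Action of the monodromy matrix on the vectors `|γ⟩` -/

section TensorKet

variable {N m : ℕ}

theorem tensorKet_smul (c : ℂ) (ψ : State N m) (a : ZMod N) :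
    tensorKet (c • ψ) a = c • tensorKet ψ a := by
  funext γ
  simp [tensorKet]

theorem tensorKet_sum {ι : Type*} (s : Finset ι) (ψ : ι → State N m) (a : ZMod N) :
    tensorKet (∑ i ∈ s, ψ i) a = ∑ i ∈ s, tensorKet (ψ i) a := by
  funext γ
  by_cases h : γ (Fin.last m) = a <;> simp [tensorKet, h]

variable (P : Params) (ψ : State N m) (a : ZMod N)

theorem opV_tensorKet :
    opV P (Fin.last m) (tensorKet ψ a) = (P.v * omegaPow a) • tensorKet ψ a := by
  funext γ
  by_cases h : γ (Fin.last m) = a <;> simp [tensorKet, opV, h]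

theorem init_add_single_last (γ : Fin (m + 1) → ZMod N) (c : ZMod N) :
    Fin.init (γ + Pi.single (Fin.last m) c) = Fin.init γ := by
  funext i
  simp [Fin.init, Fin.ext_iff, (Fin.is_lt i).ne]

theorem shiftOp_tensorKet (c : ZMod N) :
    shiftOp (Pi.single (Fin.last m) c) (tensorKet ψ a) = tensorKet ψ (a - c) := by
  funext γ
  simp [tensorKet, init_add_single_last, eq_sub_iff_add_eq]

theorem opU_tensorKet : opU P (Fin.last m) (tensorKet ψ a) = P.u • tensorKet ψ (a - 1) := by
  rw [opU, LinearMap.smul_apply, shiftOp_tensorKet]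

theorem opUinv_tensorKet :
    opUinv P (Fin.last m) (tensorKet ψ a) = P.u⁻¹ • tensorKet ψ (a + 1) := by
  rw [opUinv, LinearMap.smul_apply, ← Pi.single_neg, shiftOp_tensorKet, sub_neg_eq_add]

end TensorKet

section Ket

variable {N : ℕ} [NeZero N] (P : Params)
  (V : (m : ℕ) → Fin m → ℂ) (Y : (m : ℕ) → Fin m → (m' : ℕ) → Fin m' → ℂ)

theorem ket_succ {m : ℕ} (γ : Fin (m + 1) → ZMod N) :
    ket V Y (m + 1) γ = ∑ γ' : Fin m → ZMod N,
      (mu V Y m γ' * openQ V Y m γ' γ) • tensorKet (ket V Y m γ') (∑ k, γ k - ∑ l, γ' l) := rfl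

theorem hCoef_succ {m : ℕ} (r : Fin (m + 1)) :
    hCoef P Y (m + 1) r = P.u * ∏ l : Fin m, Y m l (m + 1) r := rfl

/-- The coefficient in `B(λ)|γ⟩`, `x = 1 / λ`, of the vector with `γ_r` lowered by one. -/
noncomputable def coefB {m : ℕ} (x : ℂ) (γ : Fin m → ZMod N) (r : Fin m) : ℂ :=
  x * (-hCoef P Y m r * ((∏ s ∈ Finset.univ.erase r, (1 + ampl P V γ s * x))
    / ∏ s ∈ Finset.univ.erase r, (1 - ampl P V γ s / ampl P V γ r)))

theorem coefB_add_single {m : ℕ} (x : ℂ) (γ : Fin m → ZMod N) (r : Fin m) :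
    coefB P V Y x (γ + Pi.single r 1) r
      = x * (-hCoef P Y m r * ((∏ s ∈ Finset.univ.erase r, (1 + ampl P V γ s * x))
        / ∏ s ∈ Finset.univ.erase r, (1 - ampl P V γ s / (ampl P V γ r * omega N)))) := by
  rw [coefB, ampl_add_single_self]
  congr 3
  · exact Finset.prod_congr rfl fun s hs => by
      rw [ampl_add_single_of_ne _ _ _ (Finset.ne_of_mem_erase hs)]
  · exact Finset.prod_congr rfl fun s hs => by
      rw [ampl_add_single_of_ne _ _ _ (Finset.ne_of_mem_erase hs)]

variable {P V Y} {n m : ℕ}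

namespace IsOpenData

/-- B on m + 1 sites is -x A ⊗ 𝒖, so in the recursive sum each term acquires the factor ∏(1 + t'_s
x). Expanding it at the m + 1 nodes -1/t_r gives the values ∏(1 - t'_l/t_r), and `openQ_sub_single`
absorbs each of these into lowering γ_r. -/
theorem monodromy_zero_one_ket_succ (hopen : IsOpenData N P n V Y) (hv : P.v ≠ 0)
    (hkappa : P.kappa ≠ 0) (hm : m + 1 ≤ n) (x : ℂ)
    (hA : ∀ γ, monodromy P N m x 0 0 (ket V Y m γ)
      = (∏ s, (1 + ampl P V γ s * x)) • ket V Y m γ) (γ : Fin (m + 1) → ZMod N) :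
    monodromy P N (m + 1) x 0 1 (ket V Y (m + 1) γ)
      = ∑ r, coefB P V Y x γ r • ket V Y (m + 1) (γ - Pi.single r 1) := by
  have hl : monodromy P N (m + 1) x 0 1 (ket V Y (m + 1) γ) = ∑ γ' : Fin m → ZMod N,
      (-x * P.u * (mu V Y m γ' * openQ V Y m γ' γ) * ∏ s, (1 + ampl P V γ' s * x))
        • tensorKet (ket V Y m γ') (∑ k, γ k - 1 - ∑ l, γ' l) := by
    rw [monodromy_succ_zero_one, ket_succ, LinearMap.neg_apply, LinearMap.smul_apply,
      Module.End.mul_apply, map_sum, map_sum, Finset.smul_sum, ← Finset.sum_neg_distrib]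
    refine Finset.sum_congr rfl fun γ' _ => ?_
    rw [map_smul, opU_tensorKet, map_smul, map_smul, liftEnd_tensorKet, hA, tensorKet_smul,
      sub_right_comm]
    module
  simp_rw [ket_succ, Finset.smul_sum, sum_sub_single]
  rw [← ket_succ, hl, Finset.sum_comm]
  refine Finset.sum_congr rfl fun γ' _ => ?_
  simp_rw [smul_smul]
  rw [← Finset.sum_smul]
  congr 1
  rw [prod_one_add_eq_lagrange (hopen.ampl_injective hv hkappa hm γ)
    (hopen.ampl_ne_zero hv hkappa hm γ), Finset.mul_sum]
  refine Finset.sum_congr rfl fun r _ => ?_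
  have h := hopen.openQ_sub_single hkappa hm γ' γ r
  rw [coefB, hCoef_succ]
  linear_combination (-x * P.u * mu V Y m γ' *
    ((∏ s ∈ Finset.univ.erase r, (1 + ampl P V γ s * x))
      / ∏ s ∈ Finset.univ.erase r, (1 - ampl P V γ s / ampl P V γ r))) * h

/-- The B-term on m sites, reindexed so that it multiplies the same vector as the A-term, has to
reproduce the interpolation value of `prod_one_add_sub_eq_lagrange` at the l-th node. This is where
the condition `amp_rec` on the y-coordinates enters. -/
theorem coef_add_single (hopen : IsOpenData N P n V Y) (hu : P.u ≠ 0) (hv : P.v ≠ 0)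
    (hkappa : P.kappa ≠ 0) (hm : m + 1 ≤ n) (γ' : Fin m → ZMod N) (γ : Fin (m + 1) → ZMod N)
    (l : Fin m) :
    mu V Y m (γ' + Pi.single l 1) * openQ V Y m (γ' + Pi.single l 1) γ
        * (P.v * omegaPow (∑ k, γ k - ∑ l, γ' l - 1) * P.u⁻¹)
        * (-hCoef P Y m l
          / ∏ s ∈ Finset.univ.erase l, (1 - ampl P V γ' s / (ampl P V γ' l * omega N)))
      = mu V Y m γ' * openQ V Y m γ' γ
        * (-ampl P V γ' l * ∏ k, (1 - ampl P V γ k / ampl P V γ' l))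
        / ∏ s ∈ Finset.univ.erase l, (1 - ampl P V γ' s / ampl P V γ' l) := by
  have hω := omega_ne_zero N
  have hm' : m ≤ n := by omega
  have hrec := hopen.amp_rec m hm l
  have hQ := hopen.openQ_add_single hkappa hm γ' γ l
  have hmu := hopen.mu_add_single hkappa hm' γ' l
  have htl := hopen.ampl_ne_zero hv hkappa hm' γ' l
  have ht := hopen.ampl_ne_zero hv hkappa hm' γ'
  have hT := hopen.ampl_ne_zero hv hkappa hm γ
  have nX1 : ∏ s ∈ Finset.univ.erase l, Y m l m s ≠ 0 := Finset.prod_ne_zero_iff.mpr fun s hs =>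
    (hopen.point_same m hm' l s (Finset.ne_of_mem_erase hs).symm).2
  have nX2 : ∏ s ∈ Finset.univ.erase l, Y m s m l ≠ 0 := Finset.prod_ne_zero_iff.mpr fun s hs =>
    (hopen.point_same m hm' s l (Finset.ne_of_mem_erase hs)).2
  have nX3 : ∏ k, Y m l (m + 1) k ≠ 0 := Finset.prod_ne_zero_iff.mpr fun k _ =>
    (hopen.point_step m hm l k).2
  have nX4 : ∏ s ∈ Finset.univ.erase l, (1 - ampl P V γ' l / ampl P V γ' s) ≠ 0 :=
    Finset.prod_ne_zero_iff.mpr fun s hs =>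
      hopen.one_sub_ampl_div_ne_zero hkappa hm' γ' γ' (Finset.ne_of_mem_erase hs).symm
  have nX5 : ∏ s ∈ Finset.univ.erase l, (1 - ampl P V γ' s / (ampl P V γ' l * omega N)) ≠ 0 :=
    Finset.prod_ne_zero_iff.mpr fun s hs => by
      rw [← ampl_add_single_self P V γ' l]
      exact hopen.one_sub_ampl_div_ne_zero hkappa hm' γ' _ (Finset.ne_of_mem_erase hs)
  have nX8 : ∏ s ∈ Finset.univ.erase l, (1 - ampl P V γ' s / ampl P V γ' l) ≠ 0 :=
    Finset.prod_ne_zero_iff.mpr fun s hs =>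
      hopen.one_sub_ampl_div_ne_zero hkappa hm' γ' γ' (Finset.ne_of_mem_erase hs)
  have nX9 : ∏ s : Fin (m - 1), Y (m - 1) s m l ≠ 0 :=
    (mul_ne_zero_iff.mp (hopen.hCoef_ne_zero hu hm' l)).2
  have nZ : ∏ s ∈ Finset.univ.erase l, ampl P V γ' s ≠ 0 :=
    Finset.prod_ne_zero_iff.mpr fun s _ => ht s
  -- `e6` and `e8` invert the ratios through (1 - t/s) s = (1 - s/t)(-t); `eT` is `amp_prod`
  -- rewritten for the amplitudes, with ω raised to the value of γ on the last site.
  have e6 : (∏ k, (1 - ampl P V γ' l / ampl P V γ k)) * ∏ k, ampl P V γ k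
      = (∏ k, (1 - ampl P V γ k / ampl P V γ' l)) * (-ampl P V γ' l) ^ (m + 1) := by
    rw [← Finset.prod_mul_distrib,
      show (-ampl P V γ' l) ^ (m + 1) = ∏ _k : Fin (m + 1), -ampl P V γ' l by simp,
      ← Finset.prod_mul_distrib]
    refine Finset.prod_congr rfl fun k _ => ?_
    have := hT k
    field_simp
    ring
  have e8 : (∏ s ∈ Finset.univ.erase l, (1 - ampl P V γ' s / ampl P V γ' l))
        * (-ampl P V γ' l) ^ (m - 1)
      = (∏ s ∈ Finset.univ.erase l, (1 - ampl P V γ' l / ampl P V γ' s))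
        * ∏ s ∈ Finset.univ.erase l, ampl P V γ' s := by
    rw [show (-ampl P V γ' l) ^ (m - 1) = ∏ _s ∈ Finset.univ.erase l, -ampl P V γ' l by
      simp [Finset.card_erase_of_mem], ← Finset.prod_mul_distrib, ← Finset.prod_mul_distrib]
    refine Finset.prod_congr rfl fun k _ => ?_
    have := ht k
    field_simp
    ring
  have eT : ∏ k, ampl P V γ k = P.kappa * P.v * omegaPow (∑ k, γ k - ∑ l, γ' l)
      * (ampl P V γ' l * ∏ s ∈ Finset.univ.erase l, ampl P V γ' s) := by
    have := omegaPow_ne_zero (∑ l, γ' l)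
    rw [Finset.mul_prod_erase _ _ (Finset.mem_univ l), prod_ampl, prod_ampl,
      hopen.amp_prod m hm, omegaPow_sub]
    field_simp
    ring
  -- The existence of l : Fin m gives m ≥ 1, so (m - 1) + 2 = m + 1 despite the truncated
  -- subtraction.
  have epow : (-ampl P V γ' l) ^ (m + 1) = (-ampl P V γ' l) ^ (m - 1) * ampl P V γ' l ^ 2 := by
    rw [← neg_sq, ← pow_add]
    congr 1
    have := l.pos
    omega
  rw [epow] at e6
  rw [Finset.prod_div_distrib] at hrec
  rw [omegaPow_sub_one, hCoef]
  generalize ampl P V γ' l = t at *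
  generalize (-t) ^ (m - 1) = w at *
  generalize ∏ s ∈ Finset.univ.erase l, Y m l m s = X1 at *
  generalize ∏ s ∈ Finset.univ.erase l, Y m s m l = X2 at *
  generalize ∏ k, Y m l (m + 1) k = X3 at *
  generalize ∏ s ∈ Finset.univ.erase l, (1 - t / ampl P V γ' s) = X4 at *
  generalize ∏ s ∈ Finset.univ.erase l, (1 - ampl P V γ' s / (t * omega N)) = X5 at *
  generalize ∏ k, (1 - t / ampl P V γ k) = X6 at *
  generalize ∏ k, (1 - ampl P V γ k / t) = X7 at *
  generalize ∏ s ∈ Finset.univ.erase l, (1 - ampl P V γ' s / t) = X8 at *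
  generalize ∏ s : Fin (m - 1), Y (m - 1) s m l = X9 at *
  generalize ∏ s ∈ Finset.univ.erase l, ampl P V γ' s = Z at *
  generalize ∏ k, ampl P V γ k = T at *
  generalize omegaPow (∑ k, γ k - ∑ l, γ' l) = E at *
  have hQ' : openQ V Y m (γ' + Pi.single l 1) γ = openQ V Y m γ' γ * (omega N * X6) / X3 := by
    rw [eq_div_iff nX3, hQ]
  have hmu' : mu V Y m (γ' + Pi.single l 1) = mu V Y m γ' * (X1 * X5) / (X4 * X2) := by
    rw [eq_div_iff (mul_ne_zero nX4 nX2), hmu]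
  have h1 : P.kappa * X2 * X3 = X1 * X9 := by
    field_simp at hrec
    linear_combination hrec
  have h2 : P.kappa * P.v * E * X6 * X8 = t * X7 * X4 := by
    refine mul_right_cancel₀ (mul_ne_zero nZ htl) ?_
    rw [eT] at e6
    linear_combination X8 * e6 + X7 * t ^ 2 * e8
  rw [hQ', hmu']
  field_simp
  linear_combination mu V Y m γ' * openQ V Y m γ' γ
    * (-X2 * X3 * h2 + X6 * X8 * P.v * E * h1)

/-- On m + 1 sites A is A(1 + ϰx𝒗) + B𝒖⁻¹𝒗. The first part is diagonal in γ'; the second lowers some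
γ'_r and raises the last site, so shifting the summation index brings both onto the same vectors.
Their coefficients add up to the new eigenvalue by `prod_one_add_sub_eq_lagrange`. -/
theorem monodromy_zero_zero_ket_succ (hopen : IsOpenData N P n V Y) (hu : P.u ≠ 0) (hv : P.v ≠ 0)
    (hkappa : P.kappa ≠ 0) (hm : m + 1 ≤ n) (x : ℂ)
    (hA : ∀ γ, monodromy P N m x 0 0 (ket V Y m γ)
      = (∏ s, (1 + ampl P V γ s * x)) • ket V Y m γ)
    (hB : ∀ γ, monodromy P N m x 0 1 (ket V Y m γ)
      = ∑ r, coefB P V Y x γ r • ket V Y m (γ - Pi.single r 1)) (γ : Fin (m + 1) → ZMod N) :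
    monodromy P N (m + 1) x 0 0 (ket V Y (m + 1) γ)
      = (∏ s, (1 + ampl P V γ s * x)) • ket V Y (m + 1) γ := by
  set E : (Fin m → ZMod N) → ZMod N := fun γ' => ∑ k, γ k - ∑ l, γ' l with hE
  set c : (Fin m → ZMod N) → ℂ := fun γ' => mu V Y m γ' * openQ V Y m γ' γ with hc
  have hket : ket V Y (m + 1) γ = ∑ γ', c γ' • tensorKet (ket V Y m γ') (E γ') := rfl
  have h1 : (liftEnd (monodromy P N m x 0 0) * (1 + (P.kappa * x) • opV P (Fin.last m)) :
          Module.End ℂ (State N (m + 1)))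
        (ket V Y (m + 1) γ)
      = ∑ γ', (c γ' * ((1 + P.kappa * P.v * omegaPow (E γ') * x)
        * ∏ s, (1 + ampl P V γ' s * x))) • tensorKet (ket V Y m γ') (E γ') := by
    rw [hket, map_sum]
    refine Finset.sum_congr rfl fun γ' _ => ?_
    rw [map_smul, Module.End.mul_apply, LinearMap.add_apply, LinearMap.smul_apply, opV_tensorKet,
      Module.End.one_apply, map_add, map_smul, map_smul, liftEnd_tensorKet, hA, tensorKet_smul]
    module
  have h2 : (liftEnd (monodromy P N m x 0 1) * (opUinv P (Fin.last m) * opV P (Fin.last m)) :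
          Module.End ℂ (State N (m + 1)))
        (ket V Y (m + 1) γ)
      = ∑ γ', (∑ r, c (γ' + Pi.single r 1) * (P.v * omegaPow (E γ' - 1) * P.u⁻¹)
        * coefB P V Y x (γ' + Pi.single r 1) r) • tensorKet (ket V Y m γ') (E γ') := by
    have h3 (γ' : Fin m → ZMod N) :
        (liftEnd (monodromy P N m x 0 1) * (opUinv P (Fin.last m) * opV P (Fin.last m)) :
          Module.End ℂ (State N (m + 1)))
          (c γ' • tensorKet (ket V Y m γ') (E γ'))
        = ∑ r, (c γ' * (P.v * omegaPow (E γ') * P.u⁻¹) * coefB P V Y x γ' r)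
          • tensorKet (ket V Y m (γ' - Pi.single r 1)) (E γ' + 1) := by
      rw [map_smul, Module.End.mul_apply, Module.End.mul_apply, opV_tensorKet, map_smul,
        opUinv_tensorKet, map_smul, map_smul, liftEnd_tensorKet, hB, tensorKet_sum]
      simp_rw [tensorKet_smul, Finset.smul_sum, smul_smul, mul_assoc]
    rw [hket, map_sum]
    simp_rw [h3, Finset.sum_smul]
    rw [Finset.sum_comm, Finset.sum_comm (s := Finset.univ (α := Fin m → ZMod N))]
    refine Finset.sum_congr rfl fun r _ => ?_
    rw [← Equiv.sum_comp (Equiv.addRight (Pi.single r 1 : Fin m → ZMod N))]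
    refine Finset.sum_congr rfl fun γ' _ => ?_
    have hE' : E (γ' + Pi.single r 1) = E γ' - 1 := by
      simp only [hE, sum_add_single]; ring
    rw [Equiv.coe_addRight, add_sub_cancel_right, hE', sub_add_cancel]
  rw [monodromy_succ_zero_zero, LinearMap.add_apply, h1, h2, ← Finset.sum_add_distrib, hket,
    Finset.smul_sum]
  refine Finset.sum_congr rfl fun γ' _ => ?_
  rw [← add_smul, smul_smul]
  congr 1
  have hm' : m ≤ n := by omega
  have hτ : ∏ k, ampl P V γ k
      = P.kappa * P.v * omegaPow (E γ') * ∏ l, ampl P V γ' l := by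
    have := omegaPow_ne_zero (∑ l, γ' l)
    rw [prod_ampl, prod_ampl, hopen.amp_prod m hm, hE, omegaPow_sub]
    field_simp
    ring
  rw [prod_one_add_sub_eq_lagrange (hopen.ampl_injective hv hkappa hm' γ')
    (hopen.ampl_ne_zero hv hkappa hm' γ') (ampl P V γ) _ hτ, add_mul ((1 + _) * _), mul_comm (c γ'),
    Finset.mul_sum, Finset.sum_mul]
  congr 1
  refine Finset.sum_congr rfl fun l _ => ?_
  have h := hopen.coef_add_single hu hv hkappa hm γ' γ l
  rw [coefB_add_single]
  simp only [hc, hE]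
  linear_combination (x * ∏ s ∈ Finset.univ.erase l, (1 + ampl P V γ' s * x)) * h

theorem monodromy_ket (hopen : IsOpenData N P n V Y) (hu : P.u ≠ 0) (hv : P.v ≠ 0)
    (hkappa : P.kappa ≠ 0) (x : ℂ) (hm : m ≤ n) :
    (∀ γ, monodromy P N m x 0 0 (ket V Y m γ)
      = (∏ s, (1 + ampl P V γ s * x)) • ket V Y m γ) ∧
    ∀ γ, monodromy P N m x 0 1 (ket V Y m γ)
      = ∑ r, coefB P V Y x γ r • ket V Y m (γ - Pi.single r 1) := by
  induction m with
  | zero => simp [monodromy_zero]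
  | succ m ih =>
    obtain ⟨hA, hB⟩ := ih (by omega)
    exact ⟨hopen.monodromy_zero_zero_ket_succ hu hv hkappa hm x hA hB,
      hopen.monodromy_zero_one_ket_succ hv hkappa hm x hA⟩

end IsOpenData

/-- The last site carries the difference of the two sums in the recursion, so |γ⟩ is supported on
configurations with total ∑γ_s. Consequently 𝒗₁⋯𝒗ₘ is diagonal on these vectors. -/
theorem ket_apply_eq_zero {γ γ' : Fin m → ZMod N} (h : ∑ s, γ' s ≠ ∑ s, γ s) :
    ket V Y m γ γ' = 0 := by
  induction m with
  | zero => simp at h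
  | succ m ih =>
    rw [ket_succ, Finset.sum_apply]
    refine Finset.sum_eq_zero fun δ _ => ?_
    rw [Pi.smul_apply, tensorKet]
    split_ifs with h1
    · rw [ih, smul_zero]
      intro h2
      refine h ?_
      rw [Fin.sum_univ_castSucc, h1, ← h2]
      simp [Fin.init]
    · exact smul_zero _

theorem diagOp_sum_ket (f : ZMod N → ℂ) (γ : Fin m → ZMod N) :
    diagOp (fun δ => f (∑ s, δ s)) (ket V Y m γ) = f (∑ s, γ s) • ket V Y m γ := by
  funext δ
  rw [diagOp_apply, Pi.smul_apply, smul_eq_mul]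
  by_cases h : ∑ s, δ s = ∑ s, γ s
  · rw [h]
  · rw [ket_apply_eq_zero h, mul_zero, mul_zero]

theorem totV_ket (γ : Fin m → ZMod N) :
    totV P N m (ket V Y m γ) = (P.v ^ m * omegaPow (∑ s, γ s)) • ket V Y m γ :=
  diagOp_sum_ket (fun a => P.v ^ m * omegaPow a) γ

theorem totVinv_ket (γ : Fin m → ZMod N) :
    totVinv P N m (ket V Y m γ) = (P.v ^ m * omegaPow (∑ s, γ s))⁻¹ • ket V Y m γ :=
  diagOp_sum_ket (fun a => (P.v ^ m * omegaPow a)⁻¹) γ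

namespace IsOpenData

/-- Apply the quantum determinant to the vector with γ_r raised, at x = -1/(ω t_r). This is a zero
of its A-eigenvalue, so the DA term drops out. All terms of B but the r-th vanish too, and that one
returns a multiple of |γ⟩, so the relation can be solved for C(ωx)|γ⟩ with ωx = -1/t_r. -/
theorem monodromy_one_zero_ket_node (hopen : IsOpenData N P n V Y) (hu : P.u ≠ 0) (hv : P.v ≠ 0)
    (hkappa : P.kappa ≠ 0) (hm : m ≤ n) (γ : Fin m → ZMod N) (r : Fin m) :
    monodromy P N m (-(ampl P V γ r)⁻¹) 1 0 (ket V Y m γ)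
      = -(ampl P V γ r / hCoef P Y m r * (-(ampl P V γ r * omega N)⁻¹) ^ m
        * (P.v ^ m * omegaPow (∑ s, γ s + 1))) • ket V Y m (γ + Pi.single r 1) := by
  have hω := omega_ne_zero N
  have ht := hopen.ampl_ne_zero hv hkappa hm γ r
  have hh := hopen.hCoef_ne_zero hu hm r
  set x : ℂ := -(ampl P V γ r * omega N)⁻¹ with hx
  obtain ⟨hA, hB⟩ := hopen.monodromy_ket hu hv hkappa x hm
  have hA0 : monodromy P N m x 0 0 (ket V Y m (γ + Pi.single r 1)) = 0 := by
    rw [hA, Finset.prod_eq_zero (Finset.mem_univ r), zero_smul]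
    rw [ampl_add_single_self, hx]
    field_simp
    ring
  have hB0 : monodromy P N m x 0 1 (ket V Y m (γ + Pi.single r 1))
      = (x * -hCoef P Y m r) • ket V Y m γ := by
    rw [hB, Finset.sum_eq_single r]
    · rw [add_sub_cancel_right, coefB_add_single]
      congr 2
      have h1 : ∏ s ∈ Finset.univ.erase r, (1 + ampl P V γ s * x)
          = ∏ s ∈ Finset.univ.erase r, (1 - ampl P V γ s / (ampl P V γ r * omega N)) :=
        Finset.prod_congr rfl fun s _ => by rw [hx, div_eq_mul_inv]; ring
      rw [h1, div_self, mul_one]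
      refine Finset.prod_ne_zero_iff.mpr fun s hs => ?_
      rw [← ampl_add_single_self P V γ r]
      exact hopen.one_sub_ampl_div_ne_zero hkappa hm γ _ (Finset.ne_of_mem_erase hs)
    · intro s _ hs
      -- For s ≠ r the product over indices other than s still contains the factor with index r,
      -- which is zero at this x.
      rw [coefB, Finset.prod_eq_zero (i := r), zero_div, mul_zero, mul_zero, zero_smul]
      · simp [hs.symm]
      · rw [ampl_add_single_self, hx]
        field_simp
        ring
    · simp
  have h := LinearMap.congr_fun (monodromy_qdet (N := N) P m x hu) (ket V Y m (γ + Pi.single r 1))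
  rw [LinearMap.sub_apply, LinearMap.smul_apply, Module.End.mul_apply, Module.End.mul_apply, hA0,
    hB0, LinearMap.neg_apply, LinearMap.smul_apply, totV_ket, sum_add_single, map_zero, sub_zero,
    map_smul, show omega N * x = -(ampl P V γ r)⁻¹ by rw [hx]; field_simp] at h
  have h2 : (hCoef P Y m r / ampl P V γ r)
        • monodromy P N m (-(ampl P V γ r)⁻¹) 1 0 (ket V Y m γ)
      = -(x ^ m • (P.v ^ m * omegaPow (∑ s, γ s + 1)) • ket V Y m (γ + Pi.single r 1)) := by
    rw [← h, smul_smul]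
    congr 1
    rw [hx]
    field_simp
  rw [← one_smul ℂ (monodromy P N m (-(ampl P V γ r)⁻¹) 1 0 (ket V Y m γ)),
    show (1 : ℂ) = ampl P V γ r / hCoef P Y m r * (hCoef P Y m r / ampl P V γ r) by field_simp,
    mul_smul, h2]
  module

theorem monodromy_one_zero_ket (hopen : IsOpenData N P n V Y) (hu : P.u ≠ 0) (hv : P.v ≠ 0)
    (hkappa : P.kappa ≠ 0) (hm : m ≤ n) (x : ℂ) (γ : Fin m → ZMod N) :
    monodromy P N m x 1 0 (ket V Y m γ)
      = ∑ r, (((∏ s ∈ Finset.univ.erase r, (1 + ampl P V γ s * x))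
          / ∏ s ∈ Finset.univ.erase r, (1 - ampl P V γ s / ampl P V γ r))
        * -(ampl P V γ r / hCoef P Y m r * (-(ampl P V γ r * omega N)⁻¹) ^ m
          * (P.v ^ m * omegaPow (∑ s, γ s + 1)))) • ket V Y m (γ + Pi.single r 1) := by
  rw [(isPolyFamily_monodromy P m).1.apply_eq_sum (hopen.ampl_injective hv hkappa hm γ)
    (hopen.ampl_ne_zero hv hkappa hm γ)]
  refine Finset.sum_congr rfl fun r _ => ?_
  rw [hopen.monodromy_one_zero_ket_node hu hv hkappa hm, smul_smul]

end IsOpenData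

end Ket

/-! ### Action of `Ã(λ)` on the vectors `|γ⟩` -/

section OneBoundary

variable {N : ℕ} [NeZero N] (P : Params) {n : ℕ}
  (V : (m : ℕ) → Fin m → ℂ) (Y : (m : ℕ) → Fin m → (m' : ℕ) → Fin m' → ℂ)

theorem matU_zero_zero (hbeta : P.beta = 0) (hdelta : P.delta = 0) (lam : ℂ) :
    matU P N n lam 0 0
      = (P.alpha * (P.theta / lam - lam))
          • (monodromyTilde P N n lam 0 0 * monodromy P N n lam⁻¹ 0 0)
        + P.eta • (monodromyTilde P N n lam 0 0 * monodromy P N n lam⁻¹ 1 0)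
        + P.eta • (monodromyTilde P N n lam 0 1 * monodromy P N n lam⁻¹ 0 0) := by
  have h : (List.ofFn fun k : Fin n => opL (N := N) P k lam).prod = monodromy P N n lam⁻¹ := by
    simp only [opL_eq_opLInv, monodromy]
  rw [matU, h]
  change (monodromyTilde P N n lam * _ * _ : Matrix (Fin 2) (Fin 2) (Module.End ℂ (State N n))) 0 0
    = _
  simp only [Matrix.mul_apply, Fin.sum_univ_two, matK, hbeta, hdelta, zero_mul, add_zero,
    Matrix.map_apply, Matrix.of_apply, Matrix.cons_val', Matrix.cons_val_zero, Matrix.cons_val_one,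
    Matrix.cons_val_fin_one, Algebra.algebraMap_eq_smul_one, mul_smul_comm, smul_mul_assoc,
    mul_one, add_mul, zero_smul]
  module

/-- `-t - ωθ / t` for `t = ϰ v_{n,s} ω^{γ_s}`. -/
noncomputable def zeta (γ : Fin n → ZMod N) (s : Fin n) : ℂ :=
  -ampl P V γ s - omega N * P.theta / ampl P V γ s

/-- The coefficient of `|γ⟩` with one component raised in `Ã(λ)|γ⟩`, up to a polynomial in `z`. -/
noncomputable def raiseCoef (γ : Fin n → ZMod N) (r : Fin n) : ℂ :=
  P.eta * ampl P V γ r ^ 2 / (P.theta * hCoef P Y n r) * (-P.theta / ampl P V γ r) ^ n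
    * ∏ s ∈ Finset.univ.erase r,
      ((ampl P V γ s / (omega N * P.theta)) / (1 - ampl P V γ s / ampl P V γ r))

/-- The A-eigenvalues at 1/λ and at λ/(ωθ) combine, factor by factor, into a function of z = λ +
ωθ/λ alone. This is why Ã(λ) is polynomial in z. -/
theorem one_add_mul_one_add_eq {t c lam : ℂ} (ht : t ≠ 0) (hc : c ≠ 0) (hlam : lam ≠ 0) :
    (1 + t * lam⁻¹) * (1 + t * (lam / c)) = t / c * (lam + c / lam - (-t - c / t)) := by
  field_simp
  ring

variable {P V Y}

namespace IsOpenData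

/-- The prefactor λ/(θ - λ²) is cancelled twice: against θ/λ - λ in the diagonal term, and against
tλ/θ - t/λ in the raising terms. The latter difference arises because one η₋ term applies A(λ/(ωθ))
after C has raised γ_r, while the other applies A(1/λ) before. -/
theorem opAt_ket (hopen : IsOpenData N P n V Y) (hu : P.u ≠ 0) (hv : P.v ≠ 0)
    (hkappa : P.kappa ≠ 0) (htheta : P.theta ≠ 0) (hbeta : P.beta = 0) (hdelta : P.delta = 0)
    {lam : ℂ} (hlam : lam ≠ 0) (hlam2 : lam ^ 2 ≠ P.theta) (γ : Fin n → ZMod N) :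
    opAt P N n lam (ket V Y n γ)
      = (P.alpha * P.kappa ^ n * ∏ s, (lam + omega N * P.theta / lam - zeta P V γ s))
          • ket V Y n γ
        + ∑ r, (raiseCoef P V Y γ r
          * ∏ s ∈ Finset.univ.erase r, (lam + omega N * P.theta / lam - zeta P V γ s))
          • ket V Y n (γ + Pi.single r 1) := by
  have hω := omega_ne_zero N
  have hc : omega N * P.theta ≠ 0 := mul_ne_zero hω htheta
  have ht := hopen.ampl_ne_zero hv hkappa le_rfl γ
  have hh := hopen.hCoef_ne_zero hu le_rfl
  have hA (x : ℂ) := (hopen.monodromy_ket hu hv hkappa x le_rfl).1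
  have hC := hopen.monodromy_one_zero_ket hu hv hkappa le_rfl
  obtain ⟨h00, h01, -, -⟩ := monodromyTilde_eq (N := N) P n hv htheta lam
  have hθ : P.theta - lam ^ 2 ≠ 0 := sub_ne_zero.mpr hlam2.symm
  rw [opAt, LinearMap.smul_apply, matU_zero_zero P hbeta hdelta, LinearMap.add_apply,
    LinearMap.add_apply, LinearMap.smul_apply, LinearMap.smul_apply, LinearMap.smul_apply,
    Module.End.mul_apply, Module.End.mul_apply, Module.End.mul_apply, hA, hC, map_smul, h00, h01,
    map_sum, smul_add, smul_add, add_assoc]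
  congr 1
  · rw [LinearMap.smul_apply, Module.End.mul_apply, hA, map_smul, totVinv_ket]
    simp only [smul_smul]
    congr 1
    have h1 : (∏ s, (1 + ampl P V γ s * lam⁻¹))
        * ∏ s, (1 + ampl P V γ s * (lam / (omega N * P.theta)))
        = (∏ s, ampl P V γ s) / (omega N * P.theta) ^ n
          * ∏ s, (lam + omega N * P.theta / lam - zeta P V γ s) := by
      rw [show (omega N * P.theta) ^ n = ∏ _s : Fin n, omega N * P.theta by simp,
        ← Finset.prod_div_distrib, ← Finset.prod_mul_distrib, ← Finset.prod_mul_distrib]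
      exact Finset.prod_congr rfl fun s _ => one_add_mul_one_add_eq (ht s) hc hlam
    rw [prod_ampl, hopen.prod_V le_rfl] at h1
    have hE := omegaPow_ne_zero (∑ s, γ s)
    have hα : lam / (P.theta - lam ^ 2) * (P.alpha * (P.theta / lam - lam)) = P.alpha := by
      field_simp
    calc _ = lam / (P.theta - lam ^ 2) * (P.alpha * (P.theta / lam - lam))
          * ((omega N * P.theta) ^ n * (P.v ^ n * omegaPow (∑ s, γ s))⁻¹)
          * ((∏ s, (1 + ampl P V γ s * lam⁻¹))
            * ∏ s, (1 + ampl P V γ s * (lam / (omega N * P.theta)))) := by ring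
      _ = _ := by
        rw [hα, h1]
        field_simp
  · rw [map_smul, LinearMap.neg_apply, LinearMap.smul_apply, Module.End.mul_apply, hC, map_sum,
      ← neg_smul]
    simp only [Finset.smul_sum]
    rw [← Finset.sum_add_distrib]
    refine Finset.sum_congr rfl fun r _ => ?_
    rw [map_smul, map_smul, LinearMap.smul_apply, Module.End.mul_apply, hA, map_smul, totVinv_ket,
      sum_add_single, ← Finset.mul_prod_erase _ _ (Finset.mem_univ r),
      ← Finset.mul_prod_erase _ (fun s => 1 + ampl P V γ s * lam⁻¹) (Finset.mem_univ r),
      ampl_add_single_self]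
    have h2 : ∏ s ∈ Finset.univ.erase r,
          (1 + ampl P V (γ + Pi.single r 1) s * (lam / (omega N * P.theta)))
        = ∏ s ∈ Finset.univ.erase r, (1 + ampl P V γ s * (lam / (omega N * P.theta))) :=
      Finset.prod_congr rfl fun s hs => by
        rw [ampl_add_single_of_ne _ _ _ (Finset.ne_of_mem_erase hs)]
    rw [h2]
    simp only [smul_smul, ← add_smul]
    congr 1
    have h1 : (∏ s ∈ Finset.univ.erase r, (1 + ampl P V γ s * lam⁻¹))
        * ∏ s ∈ Finset.univ.erase r, (1 + ampl P V γ s * (lam / (omega N * P.theta)))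
        = (∏ s ∈ Finset.univ.erase r, (ampl P V γ s / (omega N * P.theta)))
          * ∏ s ∈ Finset.univ.erase r, (lam + omega N * P.theta / lam - zeta P V γ s) := by
      rw [← Finset.prod_mul_distrib, ← Finset.prod_mul_distrib]
      exact Finset.prod_congr rfl fun s _ => one_add_mul_one_add_eq (ht s) hc hlam
    rw [raiseCoef, Finset.prod_div_distrib]
    have hE := omegaPow_ne_zero (∑ s, γ s + 1)
    have htr := ht r
    have hhr := hh r
    have hD : ∏ s ∈ Finset.univ.erase r, (1 - ampl P V γ s / ampl P V γ r) ≠ 0 :=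
      Finset.prod_ne_zero_iff.mpr fun s hs =>
        hopen.one_sub_ampl_div_ne_zero hkappa le_rfl γ γ (Finset.ne_of_mem_erase hs)
    have hpow : (omega N * P.theta) ^ n * (-(ampl P V γ r * omega N)⁻¹) ^ n
        = (-P.theta / ampl P V γ r) ^ n := by
      rw [← mul_pow]
      congr 1
      field_simp
    rw [← hpow]
    generalize (-(ampl P V γ r * omega N)⁻¹) ^ n = w
    generalize (∏ s ∈ Finset.univ.erase r, (1 + ampl P V γ s * lam⁻¹)) = X1 at *
    generalize (∏ s ∈ Finset.univ.erase r, (1 + ampl P V γ s * (lam / (omega N * P.theta)))) = X2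
      at *
    generalize ∏ s ∈ Finset.univ.erase r, (lam + omega N * P.theta / lam - zeta P V γ s) = X3 at *
    generalize ∏ s ∈ Finset.univ.erase r, (1 - ampl P V γ s / ampl P V γ r) = D at *
    generalize ∏ s ∈ Finset.univ.erase r, (ampl P V γ s / (omega N * P.theta)) = X4 at *
    generalize omegaPow (∑ s, γ s + 1) = E at *
    generalize ampl P V γ r = t at *
    generalize hCoef P Y n r = h at *
    have h3 : lam / (P.theta - lam ^ 2)
          * (t * omega N * (lam / (omega N * P.theta)) - t * lam⁻¹) = -t / P.theta := by
      field_simp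
      ring
    calc _ = -(P.eta * (omega N * P.theta) ^ n * w * t / h) * ((P.v ^ n * E) * (P.v ^ n * E)⁻¹)
          * (X1 * X2) / D
          * (lam / (P.theta - lam ^ 2)
            * (t * omega N * (lam / (omega N * P.theta)) - t * lam⁻¹)) := by ring
      _ = _ := by
        rw [h1, h3, mul_inv_cancel₀ (mul_ne_zero (pow_ne_zero n hv) hE)]
        field_simp

end IsOpenData

end OneBoundary

/-! ### The coefficients of `Ψ_σ` -/

section BoundaryCoefficients

/-- Each s ≠ r corresponds to the unique pair a < b made of r and s. In this form a product over s ≠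
r can be compared factor by factor with the product over pairs in `bdryQ`. -/
theorem prod_erase_eq_prod_pairs {n : ℕ} (g : Fin n → ℂ) (r : Fin n) :
    ∏ s ∈ Finset.univ.erase r, g s = ∏ a, ∏ b ∈ Finset.univ.filter (fun b => a < b),
      ((if a = r then g b else 1) * (if b = r then g a else 1)) := by
  have h1 : (∏ a, ∏ b ∈ Finset.univ.filter (fun b => a < b), if a = r then g b else 1)
      = ∏ b ∈ Finset.univ.filter (fun b => r < b), g b := by
    rw [Finset.prod_eq_single r (fun a _ ha => by simp [ha]) (by simp)]
    simp
  have h2 : (∏ a, ∏ b ∈ Finset.univ.filter (fun b => a < b), if b = r then g a else 1)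
      = ∏ a ∈ Finset.univ.filter (fun a => a < r), g a := by
    simp only [Finset.prod_ite_eq', Finset.mem_filter, Finset.mem_univ, true_and]
    rw [← Finset.prod_filter]
  simp only [Finset.prod_mul_distrib]
  rw [h1, h2, ← Finset.prod_union]
  · congr 1
    ext s
    simp only [Finset.mem_erase, Finset.mem_union, Finset.mem_filter, Finset.mem_univ, true_and,
      and_true]
    rw [ne_iff_lt_or_gt, or_comm]
  · rw [Finset.disjoint_filter]
    intro s _ h
    exact h.le.not_gt

variable {N : ℕ} [NeZero N] {P : Params} {n : ℕ}
  {V : (m : ℕ) → Fin m → ℂ} {Y : (m : ℕ) → Fin m → (m' : ℕ) → Fin m' → ℂ}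
  {S : Fin n → ℂ} {Yt YB YBt : Fin n → Fin n → ℂ}

/-- `ϰ s_k ω^{σ_k}`. -/
noncomputable def amplS (P : Params) (S : Fin n → ℂ) (σ : Fin n → ZMod N) (k : Fin n) : ℂ :=
  P.kappa * S k * omegaPow (σ k)

namespace IsBoundaryData

theorem amplS_ne_zero (hbdry : IsBoundaryData N P n V Y S Yt YB YBt) (hkappa : P.kappa ≠ 0)
    (σ : Fin n → ZMod N) (k : Fin n) : amplS P S σ k ≠ 0 :=
  mul_ne_zero (mul_ne_zero hkappa (hbdry.s_ne_zero k)) (omegaPow_ne_zero _)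

theorem ptT_mul_omegaPow (γ : Fin n → ZMod N) (r r' : Fin n) :
    (ptT P V Yt N r r').1 * omegaPow (γ r + γ r')
      = ampl P V γ r * ampl P V γ r' / (omega N * P.theta) := by
  rw [ptT, omegaPow_add, ampl, ampl]
  ring

theorem one_sub_ampl_mul_ne_zero (hbdry : IsBoundaryData N P n V Y S Yt YB YBt)
    (γ : Fin n → ZMod N) {r r' : Fin n} (h : r ≠ r') :
    1 - ampl P V γ r * ampl P V γ r' / (omega N * P.theta) ≠ 0 := by
  rw [← ptT_mul_omegaPow (Yt := Yt)]
  exact one_sub_omegaPow_ne_zero (hbdry.pointT r r' h) _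

theorem fermatW_ptB (hbdry : IsBoundaryData N P n V Y S Yt YB YBt) (hkappa : P.kappa ≠ 0)
    (γ σ : Fin n → ZMod N) (r k : Fin n) :
    fermatW (ptB V S YB r k) (γ r - σ k) * (1 - ampl P V γ r / amplS P S σ k)
      = fermatW (ptB V S YB r k) (γ r - 1 - σ k) * YB r k := by
  have hp := hbdry.pointB r k
  have h : (ptB V S YB r k).1 * omegaPow (γ r - σ k) = ampl P V γ r / amplS P S σ k := by
    rw [omegaPow_sub, ampl, amplS, ptB, mul_assoc, mul_assoc, mul_div_mul_left _ _ hkappa,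
      div_mul_div_comm]
  rw [fermatW_eq hp, ← h, mul_assoc, div_mul_cancel₀ _ (one_sub_omegaPow_ne_zero hp _),
    sub_right_comm]
  rfl

theorem fermatW_ptBT (hbdry : IsBoundaryData N P n V Y S Yt YB YBt)
    (γ σ : Fin n → ZMod N) (r k : Fin n) :
    fermatW (ptBT P V S YBt N r k) (γ r + σ k)
        * (1 - ampl P V γ r * amplS P S σ k / (omega N * P.theta))
      = fermatW (ptBT P V S YBt N r k) (γ r - 1 + σ k) * YBt r k := by
  have hp := hbdry.pointBT r k
  have h : (ptBT P V S YBt N r k).1 * omegaPow (γ r + σ k)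
      = ampl P V γ r * amplS P S σ k / (omega N * P.theta) := by
    rw [omegaPow_add, ampl, amplS, ptBT]
    ring
  rw [fermatW_eq hp, ← h, mul_assoc, div_mul_cancel₀ _ (one_sub_omegaPow_ne_zero hp _),
    show γ r - 1 + σ k = γ r + σ k - 1 by ring]
  rfl

theorem fermatW_ptT (hbdry : IsBoundaryData N P n V Y S Yt YB YBt)
    (γ : Fin n → ZMod N) {r r' : Fin n} (h : r ≠ r') :
    fermatW (ptT P V Yt N r r') (γ r + γ r')
        * (1 - ampl P V γ r * ampl P V γ r' / (omega N * P.theta))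
      = fermatW (ptT P V Yt N r r') (γ r + γ r' - 1) * Yt r r' := by
  have hp := hbdry.pointT r r' h
  rw [fermatW_eq hp, ← ptT_mul_omegaPow (Yt := Yt), mul_assoc,
    div_mul_cancel₀ _ (one_sub_omegaPow_ne_zero hp _)]
  rfl

/-- The dependence of `Q(γ, σ)` on `γ`. -/
theorem bdryQ_sub_single (hbdry : IsBoundaryData N P n V Y S Yt YB YBt) (hkappa : P.kappa ≠ 0)
    (γ σ : Fin n → ZMod N) (r : Fin n) :
    bdryQ P V S Yt YB YBt γ σ
        * (∏ k, ((1 - ampl P V γ r / amplS P S σ k)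
          * (1 - ampl P V γ r * amplS P S σ k / (omega N * P.theta))))
        * (∏ s ∈ Finset.univ.erase r, Yt r s)
        * ∏ s ∈ Finset.univ.erase r, (ampl P V γ r / omega N - ampl P V γ s)
      = bdryQ P V S Yt YB YBt (γ - Pi.single r 1) σ * omegaPow (γ r) ^ 2
        * (∏ k, YB r k * YBt r k)
        * (∏ s ∈ Finset.univ.erase r, (1 - ampl P V γ r * ampl P V γ s / (omega N * P.theta)))
        * ∏ s ∈ Finset.univ.erase r, (ampl P V γ r - ampl P V γ s) := by
  have hδr : (γ - Pi.single r 1 : Fin n → ZMod N) r = γ r - 1 := by simp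
  have hδ (s : Fin n) (hs : s ≠ r) : (γ - Pi.single r 1 : Fin n → ZMod N) s = γ s := by simp [hs]
  generalize γ - Pi.single r 1 = δ at *
  -- Lowering γ_r by one decreases γ_r² + γ_r by 2γ_r. This supplies the ω^{2γ_r} that completes
  -- v_{n,r}² in the constraint to the squared amplitude.
  have h1 : ∏ s, omegaPow (γ s ^ 2 + γ s)
      = (∏ s, omegaPow (δ s ^ 2
          + δ s)) * omegaPow (γ r) ^ 2 := by
    rw [← Finset.mul_prod_erase _ _ (Finset.mem_univ r),
      ← Finset.mul_prod_erase _ (fun s => omegaPow (δ s ^ 2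
          + δ s)) (Finset.mem_univ r), mul_right_comm]
    congr 1
    · rw [sq (omegaPow (γ r)), ← omegaPow_add, ← omegaPow_add, hδr]
      congr 1
      ring
    · exact Finset.prod_congr rfl fun s hs => by rw [hδ s (Finset.ne_of_mem_erase hs)]
  have h2 : (∏ k, ∏ s, fermatW (ptB V S YB s k) (γ s - σ k)
        * fermatW (ptBT P V S YBt N s k) (γ s + σ k))
        * (∏ k, ((1 - ampl P V γ r / amplS P S σ k)
          * (1 - ampl P V γ r * amplS P S σ k / (omega N * P.theta))))
      = (∏ k, ∏ s, fermatW (ptB V S YB s k) (δ s - σ k)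
        * fermatW (ptBT P V S YBt N s k) (δ s + σ k))
        * ∏ k, YB r k * YBt r k := by
    rw [← Finset.prod_mul_distrib, ← Finset.prod_mul_distrib]
    refine Finset.prod_congr rfl fun k _ => ?_
    rw [← Finset.mul_prod_erase _ _ (Finset.mem_univ r),
      ← Finset.mul_prod_erase _ (fun s => fermatW (ptB V S YB s k)
        (δ s - σ k) * fermatW (ptBT P V S YBt N s k)
        (δ s + σ k)) (Finset.mem_univ r), mul_right_comm,
      mul_right_comm _ _ (YB r k * YBt r k)]
    congr 1
    · rw [mul_mul_mul_comm, hbdry.fermatW_ptB hkappa, hbdry.fermatW_ptBT, hδr]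
      ring
    · exact Finset.prod_congr rfl fun s hs => by rw [hδ s (Finset.ne_of_mem_erase hs)]
  have h3 : (∏ a, ∏ b ∈ Finset.univ.filter (fun b => a < b),
        (V n a * omegaPow (γ a) - V n b * omegaPow (γ b)) / fermatW (ptT P V Yt N a b) (γ a + γ b))
        * ((∏ s ∈ Finset.univ.erase r, Yt r s)
        * ∏ s ∈ Finset.univ.erase r, (ampl P V γ r / omega N - ampl P V γ s))
      = (∏ a, ∏ b ∈ Finset.univ.filter (fun b => a < b),
        (V n a * omegaPow (δ a)
          - V n b * omegaPow (δ b))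
          / fermatW (ptT P V Yt N a b) (δ a
            + δ b))
        * ((∏ s ∈ Finset.univ.erase r, (1 - ampl P V γ r * ampl P V γ s / (omega N * P.theta)))
        * ∏ s ∈ Finset.univ.erase r, (ampl P V γ r - ampl P V γ s)) := by
    rw [← Finset.prod_mul_distrib, ← Finset.prod_mul_distrib, prod_erase_eq_prod_pairs,
      prod_erase_eq_prod_pairs]
    simp only [← Finset.prod_mul_distrib]
    refine Finset.prod_congr rfl fun a _ => Finset.prod_congr rfl fun b hb => ?_
    have hab : a < b := (Finset.mem_filter.mp hb).2
    have hT := hbdry.fermatW_ptT γ hab.ne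
    have w1 := fermatW_ne_zero (hbdry.pointT a b hab.ne) (γ a + γ b)
    have w2 := fermatW_ne_zero (hbdry.pointT a b hab.ne) (γ a + γ b - 1)
    by_cases ha : a = r
    · subst ha
      simp only [if_true, if_neg hab.ne', hδr, hδ b hab.ne', mul_one, omegaPow_sub_one]
      rw [show γ a - 1 + γ b = γ a + γ b - 1 by ring, div_mul_eq_mul_div, div_mul_eq_mul_div,
        div_eq_div_iff w1 w2]
      have e1 : V n a * omegaPow (γ a) - V n b * omegaPow (γ b)
          = (ampl P V γ a - ampl P V γ b) / P.kappa := by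
        rw [ampl, ampl]; field_simp
      have e2 : V n a * (omegaPow (γ a) / omega N) - V n b * omegaPow (γ b)
          = (ampl P V γ a / omega N - ampl P V γ b) / P.kappa := by
        rw [ampl, ampl]; field_simp
      rw [e1, e2]
      linear_combination -((ampl P V γ a - ampl P V γ b) / P.kappa
        * (ampl P V γ a / omega N - ampl P V γ b)) * hT
    -- When r is the larger index, the differences in `bdryQ` have the opposite sign on both sides,
    -- and the symmetry of the y-coordinates is needed.
    · by_cases hb' : b = r
      · subst hb'
        simp only [if_true, if_neg ha, hδr, hδ a ha, one_mul, omegaPow_sub_one]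
        rw [show γ a + (γ b - 1) = γ a + γ b - 1 by ring, div_mul_eq_mul_div, div_mul_eq_mul_div,
          div_eq_div_iff w1 w2, hbdry.symmT b a (Ne.symm ha)]
        have e1 : V n a * omegaPow (γ a) - V n b * omegaPow (γ b)
            = (ampl P V γ a - ampl P V γ b) / P.kappa := by
          rw [ampl, ampl]; field_simp
        have e2 : V n a * omegaPow (γ a) - V n b * (omegaPow (γ b) / omega N)
            = (ampl P V γ a - ampl P V γ b / omega N) / P.kappa := by
          rw [ampl, ampl]; field_simp
        rw [e1, e2]
        linear_combination ((ampl P V γ a - ampl P V γ b) / P.kappa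
          * (ampl P V γ a - ampl P V γ b / omega N)) * hT
      · simp [ha, hb', hδ a ha, hδ b hb']
  rw [bdryQ, bdryQ, h1]
  linear_combination (exp := 1) (∏ s, omegaPow (δ s ^ 2
      + δ s)) * omegaPow (γ r) ^ 2
    * ((∏ a, ∏ b ∈ Finset.univ.filter (fun b => a < b),
        (V n a * omegaPow (γ a) - V n b * omegaPow (γ b)) / fermatW (ptT P V Yt N a b) (γ a + γ b))
        * ((∏ s ∈ Finset.univ.erase r, Yt r s)
        * ∏ s ∈ Finset.univ.erase r, (ampl P V γ r / omega N - ampl P V γ s)) * h2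
      + (∏ k, ∏ s, fermatW (ptB V S YB s k) (δ s - σ k)
        * fermatW (ptBT P V S YBt N s k) (δ s + σ k))
        * (∏ k, YB r k * YBt r k) * h3)

end IsBoundaryData

end BoundaryCoefficients

/-! ### The eigenvalue equation for `Ψ_σ` -/

section Eigenvector

open Polynomial

theorem degree_prod_X_sub_C_sub_lt {n : ℕ} {p : ℂ[X]} (hp : p.Monic) (hd : p.degree = n)
    (a : Fin n → ℂ) : ((∏ k, (X - C (a k)) : ℂ[X]) - p).degree < n := by
  have hd' : (∏ k, (X - C (a k)) : ℂ[X]).degree = n := by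
    rw [degree_prod]; simp
  have hm : (∏ k, (X - C (a k)) : ℂ[X]).Monic := monic_prod_of_monic _ _ fun k _ => monic_X_sub_C _
  exact hd' ▸ degree_sub_lt_left (hd'.trans hd.symm) hm.ne_zero (hm.trans hp.symm)

/-- Both products are monic of degree n, so their difference is determined by its values at the n
points b_r, where the second product vanishes. With a = z_k and b = ζ_s this is the eigenvalue
equation after comparison of coefficients. -/
theorem prod_sub_eq_lagrange {n : ℕ} {a b : Fin n → ℂ} (hb : Function.Injective b) (z : ℂ) :
    ∏ k, (z - a k) = ∏ s, (z - b s)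
      + ∑ r, (∏ k, (b r - a k)) / (∏ s ∈ Finset.univ.erase r, (b r - b s))
        * ∏ s ∈ Finset.univ.erase r, (z - b s) := by
  have hm : (∏ k, (X - C (b k)) : ℂ[X]).Monic := monic_prod_of_monic _ _ fun k _ => monic_X_sub_C _
  have h := eval_eq_sum_lagrange hb
    (degree_prod_X_sub_C_sub_lt hm (by rw [degree_prod]; simp) a) z
  simp only [eval_sub, eval_X, eval_C, eval_prod] at h
  rw [sub_eq_iff_eq_add'.mp h]
  congr 1
  refine Finset.sum_congr rfl fun r _ => ?_
  rw [Finset.prod_eq_zero (i := r) (f := fun s => b r - b s) (Finset.mem_univ r) (sub_self _),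
    sub_zero, Finset.prod_div_distrib]
  ring

variable {N : ℕ} [NeZero N] {P : Params} {n : ℕ}
  {V : (m : ℕ) → Fin m → ℂ} {Y : (m : ℕ) → Fin m → (m' : ℕ) → Fin m' → ℂ}
  {S : Fin n → ℂ} {Yt YB YBt : Fin n → Fin n → ℂ}

/-- The function t + c/t takes equal values only at t = s and ts = c. The two factors are governed
by the points p_{n,r;n,s} and p̃_{r,s}, which makes the ζ_s distinct. -/
theorem zeta_sub_zeta (htheta : P.theta ≠ 0) {γ : Fin n → ZMod N} (h0 : ∀ s, ampl P V γ s ≠ 0)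
    (r s : Fin n) :
    (zeta P V γ r - zeta P V γ s) * (ampl P V γ r * (ampl P V γ s / (omega N * P.theta)))
      = (ampl P V γ r - ampl P V γ s)
        * (1 - ampl P V γ r * ampl P V γ s / (omega N * P.theta)) := by
  have hω := omega_ne_zero N
  have := h0 r
  have := h0 s
  rw [zeta, zeta]
  field_simp
  ring

/-- `λ_k + ωθ / λ_k`. -/
noncomputable def zK (P : Params) (S : Fin n → ℂ) (σ : Fin n → ZMod N) (k : Fin n) : ℂ :=
  lamK P S σ k + omega N * P.theta / lamK P S σ k

theorem lamK_eq (σ : Fin n → ZMod N) (k : Fin n) : lamK P S σ k = -amplS P S σ k := by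
  rw [lamK, amplS]; ring

/-- The two factors are the denominators in the step relations at p^B_{r,k} and p̃^B_{r,k}. -/
theorem zeta_sub_zK (htheta : P.theta ≠ 0) {γ σ : Fin n → ZMod N} {r k : Fin n}
    (h0 : ampl P V γ r ≠ 0) (h1 : amplS P S σ k ≠ 0) :
    zeta P V γ r - zK P S σ k = -(omega N * P.theta) / ampl P V γ r
      * ((1 - ampl P V γ r / amplS P S σ k)
        * (1 - ampl P V γ r * amplS P S σ k / (omega N * P.theta))) := by
  have hω := omega_ne_zero N
  rw [zeta, zK, lamK_eq]
  field_simp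
  ring

namespace IsBoundaryData

theorem zeta_injective (hbdry : IsBoundaryData N P n V Y S Yt YB YBt)
    (hopen : IsOpenData N P n V Y) (hv : P.v ≠ 0)
    (hkappa : P.kappa ≠ 0) (htheta : P.theta ≠ 0) (γ : Fin n → ZMod N) :
    Function.Injective (zeta P V γ) := by
  intro r s e
  by_contra hrs
  have h := zeta_sub_zeta htheta (hopen.ampl_ne_zero hv hkappa le_rfl γ) r s
  rw [e, sub_self, zero_mul, eq_comm, mul_eq_zero] at h
  rcases h with h | h
  · exact hopen.ampl_ne hv hkappa le_rfl γ γ hrs (sub_eq_zero.mp h)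
  · exact hbdry.one_sub_ampl_mul_ne_zero γ hrs h

/-- This is the separated equation, one for each r. The step relations of Q produce all factors of
the interpolation coefficient, and the remaining factor independent of γ and σ is matched by
`constraint`. -/
theorem bdryQ_mul_raiseCoef (hbdry : IsBoundaryData N P n V Y S Yt YB YBt)
    (hopen : IsOpenData N P n V Y) (hu : P.u ≠ 0) (hv : P.v ≠ 0)
    (hkappa : P.kappa ≠ 0) (htheta : P.theta ≠ 0) (γ σ : Fin n → ZMod N) (r : Fin n) :
    bdryQ P V S Yt YB YBt (γ - Pi.single r 1) σ * raiseCoef P V Y (γ - Pi.single r 1) r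
      = P.alpha * P.kappa ^ n * bdryQ P V S Yt YB YBt γ σ
        * ((∏ k, (zeta P V γ r - zK P S σ k))
          / ∏ s ∈ Finset.univ.erase r, (zeta P V γ r - zeta P V γ s)) := by
  have hω := omega_ne_zero N
  have hc : omega N * P.theta ≠ 0 := mul_ne_zero hω htheta
  have h0 := hopen.ampl_ne_zero hv hkappa le_rfl γ
  have htr := h0 r
  have hh := hopen.hCoef_ne_zero hu le_rfl r
  have hQ := hbdry.bdryQ_sub_single hkappa γ σ r
  have hcon := hbdry.constraint r
  have n2 : ∏ s ∈ Finset.univ.erase r, Yt r s ≠ 0 := Finset.prod_ne_zero_iff.mpr fun s hs =>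
    (hbdry.pointT r s (Finset.ne_of_mem_erase hs).symm).2
  have hsub (s : Fin n) (hs : s ≠ r) : 1 - ampl P V γ s / (ampl P V γ r / omega N) ≠ 0 := by
    rw [← ampl_sub_single_self]
    exact hopen.one_sub_ampl_div_ne_zero hkappa le_rfl γ _ hs
  have hr (s : Fin n) : 1 - ampl P V γ s / (ampl P V γ r / omega N)
      = (ampl P V γ r / omega N - ampl P V γ s) * (omega N / ampl P V γ r) := by
    field_simp
  have n3 : ∏ s ∈ Finset.univ.erase r, (ampl P V γ r / omega N - ampl P V γ s) ≠ 0 :=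
    Finset.prod_ne_zero_iff.mpr fun s hs h => hsub s (Finset.ne_of_mem_erase hs) <| by
      rw [hr, h, zero_mul]
  have n5 : ∏ s ∈ Finset.univ.erase r,
      (1 - ampl P V γ r * ampl P V γ s / (omega N * P.theta)) ≠ 0 :=
    Finset.prod_ne_zero_iff.mpr fun s hs =>
      hbdry.one_sub_ampl_mul_ne_zero γ (Finset.ne_of_mem_erase hs).symm
  have n6 : ∏ s ∈ Finset.univ.erase r, (ampl P V γ r - ampl P V γ s) ≠ 0 :=
    Finset.prod_ne_zero_iff.mpr fun s hs => sub_ne_zero.mpr <|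
      hopen.ampl_ne hv hkappa le_rfl γ γ (Finset.ne_of_mem_erase hs).symm
  have nc : ∏ s ∈ Finset.univ.erase r, (ampl P V γ s / (omega N * P.theta)) ≠ 0 :=
    Finset.prod_ne_zero_iff.mpr fun s _ => div_ne_zero (h0 s) hc
  have hpow (a : ℂ) : a ^ (n - 1) = ∏ _s ∈ Finset.univ.erase r, a := by
    simp [Finset.card_erase_of_mem]
  have eP : ∏ k, (zeta P V γ r - zK P S σ k) = (-(omega N * P.theta) / ampl P V γ r) ^ n
      * ∏ k, ((1 - ampl P V γ r / amplS P S σ k)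
        * (1 - ampl P V γ r * amplS P S σ k / (omega N * P.theta))) := by
    rw [show (-(omega N * P.theta) / ampl P V γ r) ^ n
      = ∏ _k : Fin n, -(omega N * P.theta) / ampl P V γ r by
        rw [Finset.prod_const, Finset.card_univ, Fintype.card_fin], ← Finset.prod_mul_distrib]
    exact Finset.prod_congr rfl fun k _ =>
      zeta_sub_zK htheta htr (hbdry.amplS_ne_zero hkappa σ k)
  have eD : (∏ s ∈ Finset.univ.erase r, (zeta P V γ r - zeta P V γ s))
      * (ampl P V γ r ^ (n - 1)
        * ∏ s ∈ Finset.univ.erase r, (ampl P V γ s / (omega N * P.theta)))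
      = (∏ s ∈ Finset.univ.erase r, (ampl P V γ r - ampl P V γ s))
        * ∏ s ∈ Finset.univ.erase r,
          (1 - ampl P V γ r * ampl P V γ s / (omega N * P.theta)) := by
    rw [hpow, ← Finset.prod_mul_distrib, ← Finset.prod_mul_distrib, ← Finset.prod_mul_distrib]
    exact Finset.prod_congr rfl fun s _ => zeta_sub_zeta htheta h0 r s
  have eR : raiseCoef P V Y (γ - Pi.single r 1) r
      = P.eta * (ampl P V γ r / omega N) ^ 2 / (P.theta * hCoef P Y n r)
        * (-(omega N * P.theta) / ampl P V γ r) ^ n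
        * ((∏ s ∈ Finset.univ.erase r, (ampl P V γ s / (omega N * P.theta)))
          * (ampl P V γ r ^ (n - 1) / omega N ^ (n - 1))
          / ∏ s ∈ Finset.univ.erase r, (ampl P V γ r / omega N - ampl P V γ s)) := by
    rw [raiseCoef, ampl_sub_single_self]
    congr 1
    · congr 2
      field_simp
    · rw [← div_pow, hpow, ← Finset.prod_mul_distrib, ← Finset.prod_div_distrib]
      refine Finset.prod_congr rfl fun s hs => ?_
      have hs' := Finset.ne_of_mem_erase hs
      have h3 := (mul_ne_zero_iff.mp (hr s ▸ hsub s hs')).1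
      rw [ampl_sub_single_of_ne _ _ _ hs', hr]
      field_simp
  -- In the lowered raising coefficient, ω² comes from the square of t/ω and ω^{n-1} from the n - 1
  -- factors with s ≠ r.
  have hω1 : omega N ^ (n + 1) = omega N ^ (n - 1) * omega N ^ 2 := by
    rw [← pow_add]
    congr 1
    have := r.pos
    omega
  have hV : ampl P V γ r = P.kappa * V n r * omegaPow (γ r) := rfl
  have npw : ampl P V γ r ^ (n - 1) ≠ 0 := pow_ne_zero _ htr
  have no : omega N ^ (n - 1) ≠ 0 := pow_ne_zero _ hω
  have nk : P.kappa ^ n ≠ 0 := pow_ne_zero _ hkappa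
  rw [eR, eP]
  -- The exponent n - 2 is an integer, negative for n = 1. Split as ϰⁿ/ϰ², it yields the ϰ² that
  -- belongs to the squared amplitude.
  rw [hω1, zpow_sub₀ hkappa, zpow_natCast, show P.kappa ^ (2 : ℤ) = P.kappa ^ 2 from rfl] at hcon
  generalize ∏ s ∈ Finset.univ.erase r, (zeta P V γ r - zeta P V γ s) = D at *
  generalize (-(omega N * P.theta) / ampl P V γ r) ^ n = G at *
  generalize ∏ k, ((1 - ampl P V γ r / amplS P S σ k)
        * (1 - ampl P V γ r * amplS P S σ k / (omega N * P.theta))) = W1 at *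
  generalize ∏ s ∈ Finset.univ.erase r, Yt r s = W2 at *
  generalize ∏ s ∈ Finset.univ.erase r, (ampl P V γ r / omega N - ampl P V γ s) = W3 at *
  generalize ∏ k, YB r k * YBt r k = W4 at *
  generalize ∏ s ∈ Finset.univ.erase r,
      (1 - ampl P V γ r * ampl P V γ s / (omega N * P.theta)) = W5 at *
  generalize ∏ s ∈ Finset.univ.erase r, (ampl P V γ r - ampl P V γ s) = W6 at *
  generalize ∏ s ∈ Finset.univ.erase r, (ampl P V γ s / (omega N * P.theta)) = Wc at *
  generalize ampl P V γ r ^ (n - 1) = pw at *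
  generalize omega N ^ (n - 1) = o at *
  generalize P.kappa ^ n = kn at *
  generalize ampl P V γ r = t at *
  generalize hCoef P Y n r = h at *
  generalize bdryQ P V S Yt YB YBt (γ - Pi.single r 1) σ = Q0 at *
  generalize bdryQ P V S Yt YB YBt γ σ = Q at *
  have hD : D = W6 * W5 / (pw * Wc) := by
    rw [eq_div_iff (mul_ne_zero npw nc), eD]
  have hcon' : P.eta * t ^ 2 * W2
      = P.alpha * h * W4 * kn * omega N ^ 2 * o * P.theta * omegaPow (γ r) ^ 2 := by
    rw [hV]
    field_simp at hcon
    linear_combination omegaPow (γ r) ^ 2 * hcon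
  have key : Q0 * P.eta * t ^ 2 * W5 * W6
      = P.alpha * kn * Q * W1 * W3 * omega N ^ 2 * o * P.theta * h := by
    refine mul_right_cancel₀ n2 ?_
    linear_combination Q0 * W5 * W6 * hcon'
      - P.alpha * kn * omega N ^ 2 * o * P.theta * h * hQ
  rw [hD]
  field_simp
  linear_combination G * key

end IsBoundaryData

theorem opAt_Psi (hopen : IsOpenData N P n V Y) (hbdry : IsBoundaryData N P n V Y S Yt YB YBt)
    (hu : P.u ≠ 0) (hv : P.v ≠ 0) (hkappa : P.kappa ≠ 0) (htheta : P.theta ≠ 0)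
    (hbeta : P.beta = 0) (hdelta : P.delta = 0) (σ : Fin n → ZMod N)
    {lam : ℂ} (hlam : lam ≠ 0) (hlam2 : lam ^ 2 ≠ P.theta) :
    opAt P N n lam (Psi P V Y S Yt YB YBt σ)
      = (P.alpha * P.kappa ^ n * ∏ k, (lam + omega N * P.theta / lam - zK P S σ k))
        • Psi P V Y S Yt YB YBt σ := by
  rw [Psi, map_sum, Finset.smul_sum]
  simp only [map_smul, hopen.opAt_ket hu hv hkappa htheta hbeta hdelta hlam hlam2, smul_add,
    Finset.smul_sum, smul_smul]
  rw [Finset.sum_add_distrib, Finset.sum_comm (s := Finset.univ (α := Fin n → ZMod N))]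
  generalize lam + omega N * P.theta / lam = z
  have h (r : Fin n) : ∑ γ, (bdryQ P V S Yt YB YBt γ σ * (raiseCoef P V Y γ r
        * ∏ s ∈ Finset.univ.erase r, (z - zeta P V γ s))) • ket V Y n (γ + Pi.single r 1)
      = ∑ γ, (P.alpha * P.kappa ^ n * bdryQ P V S Yt YB YBt γ σ
        * ((∏ k, (zeta P V γ r - zK P S σ k))
          / ∏ s ∈ Finset.univ.erase r, (zeta P V γ r - zeta P V γ s))
        * ∏ s ∈ Finset.univ.erase r, (z - zeta P V γ s)) • ket V Y n γ := by
    -- Reindexing by γ ↦ γ - e_r turns raised vectors into |γ⟩; the product over s ≠ r is unaffected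
    -- since it does not involve γ_r.
    rw [← Equiv.sum_comp (Equiv.subRight (Pi.single r 1 : Fin n → ZMod N))]
    refine Finset.sum_congr rfl fun γ _ => ?_
    rw [Equiv.subRight_apply, sub_add_cancel,
      ← hbdry.bdryQ_mul_raiseCoef hopen hu hv hkappa htheta, ← mul_assoc]
    congr 2
    refine Finset.prod_congr rfl fun s hs => ?_
    rw [zeta, zeta, ampl_sub_single_of_ne _ _ _ (Finset.ne_of_mem_erase hs)]
  simp_rw [h]
  rw [Finset.sum_comm, ← Finset.sum_add_distrib]
  refine Finset.sum_congr rfl fun γ _ => ?_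
  rw [← Finset.sum_smul, ← add_smul, prod_sub_eq_lagrange
    (a := zK P S σ) (hbdry.zeta_injective hopen hv hkappa htheta γ) z, mul_add, add_mul, Finset.mul_sum,
    Finset.sum_mul]
  congr 2
  · ring
  · exact Finset.sum_congr rfl fun r _ => by ring

end Eigenvector

/-! ### The vectors `|γ⟩` form a basis -/

section Basis

open Polynomial

variable {N : ℕ} [NeZero N] {P : Params} {n m : ℕ}
  {V : (m : ℕ) → Fin m → ℂ} {Y : (m : ℕ) → Fin m → (m' : ℕ) → Fin m' → ℂ}
  {S : Fin n → ℂ} {Yt YB YBt : Fin n → Fin n → ℂ}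

namespace IsOpenData

/-- The zeros -1/t_r of the eigenvalue polynomial determine γ, because amplitudes with different
indices never coincide, even for different γ. The product of all differences of these finitely many
polynomials is thus nonzero, and any x that is not one of its zeros will do. -/
theorem exists_injective_eigenvalue (hopen : IsOpenData N P n V Y) (hv : P.v ≠ 0)
    (hkappa : P.kappa ≠ 0) (hm : m ≤ n) :
    ∃ x : ℂ, Function.Injective fun γ : Fin m → ZMod N => ∏ s, (1 + ampl P V γ s * x) := by
  set p : (Fin m → ZMod N) → ℂ[X] := fun γ => ∏ s, (1 + C (ampl P V γ s) * X) with hp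
  have he (γ : Fin m → ZMod N) (x : ℂ) : (p γ).eval x = ∏ s, (1 + ampl P V γ s * x) := by
    simp [hp, eval_prod]
  have hinj : Function.Injective p := by
    intro γ γ' h
    funext r
    have ht := hopen.ampl_ne_zero hv hkappa hm γ r
    have h1 : (p γ').eval (-(ampl P V γ r)⁻¹) = 0 := by
      rw [← h, he]
      exact Finset.prod_eq_zero (Finset.mem_univ r) (by field_simp; ring)
    rw [he, Finset.prod_eq_zero_iff] at h1
    obtain ⟨s, -, hs⟩ := h1
    have h2 : ampl P V γ' s = ampl P V γ r := by
      field_simp at hs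
      linear_combination -hs
    obtain rfl : s = r := by
      by_contra hsr
      exact hopen.ampl_ne hv hkappa hm γ' γ hsr h2
    exact omegaPow_injective
      (mul_left_cancel₀ (mul_ne_zero hkappa (hopen.V_ne_zero hv hm s)) h2.symm)
  have hne : ∏ q ∈ (Finset.univ : Finset (Fin m → ZMod N)).offDiag, (p q.1 - p q.2) ≠ 0 :=
    Finset.prod_ne_zero_iff.mpr fun q hq =>
      sub_ne_zero.mpr (hinj.ne (Finset.mem_offDiag.mp hq).2.2)
  obtain ⟨x, hx⟩ : ∃ x : ℂ, (∏ q ∈ (Finset.univ : Finset (Fin m → ZMod N)).offDiag,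
      (p q.1 - p q.2)).eval x ≠ 0 := by
    by_contra! h
    exact hne (Polynomial.funext fun x => by rw [h, eval_zero])
  refine ⟨x, fun γ γ' h => ?_⟩
  by_contra hγ
  rw [eval_prod, Finset.prod_ne_zero_iff] at hx
  refine hx (γ, γ') (by simpa using hγ) ?_
  rw [eval_sub, he, he]
  exact sub_eq_zero.mpr h

/-- Eigenvectors for distinct eigenvalues of A(x) are independent once they are nonzero, and
nonvanishing on m + 1 sites follows from independence on m sites. -/
theorem linearIndependent_ket (hopen : IsOpenData N P n V Y) (hu : P.u ≠ 0) (hv : P.v ≠ 0)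
    (hkappa : P.kappa ≠ 0) (hm : m ≤ n) :
    LinearIndependent ℂ fun γ : Fin m → ZMod N => ket V Y m γ := by
  have key {m : ℕ} (hm : m ≤ n) (h0 : ∀ γ, ket (N := N) V Y m γ ≠ 0) :
      LinearIndependent ℂ fun γ : Fin m → ZMod N => ket V Y m γ := by
    obtain ⟨x, hx⟩ := hopen.exists_injective_eigenvalue hv hkappa hm
    exact Module.End.eigenvectors_linearIndependent' (monodromy P N m x 0 0) _ hx _ fun γ =>
      ⟨Module.End.mem_eigenspace_iff.mpr ((hopen.monodromy_ket hu hv hkappa x hm).1 γ), h0 γ⟩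
  induction m with
  | zero => exact key hm fun γ h => one_ne_zero (α := ℂ) (congrFun h 0)
  | succ m ih =>
    refine key hm fun γ h => ?_
    have hli := ih (by omega)
    rw [Fintype.linearIndependent_iff] at hli
    set a : ZMod N := ∑ k, γ k with ha
    -- Restricted to the value a of the last coordinate, the recursive sum keeps only those γ' with
    -- zero total. The index γ' = 0 is among them, and its coefficient is nonzero.
    have h1 := hli (fun γ' => if a = a - ∑ l, γ' l then mu V Y m γ' * openQ V Y m γ' γ else 0) ?_ 0
    · simp only [Pi.zero_apply, Finset.sum_const_zero, sub_zero, if_true] at h1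
      exact mul_ne_zero (hopen.mu_ne_zero (by omega) _) (hopen.openQ_ne_zero hm _ _) h1
    · funext δ
      have h2 := congrFun h (Fin.snoc (α := fun _ => ZMod N) δ a)
      rw [ket_succ, Finset.sum_apply] at h2
      rw [Finset.sum_apply]
      refine Eq.trans (Finset.sum_congr rfl fun γ' _ => ?_) h2
      simp only [Pi.smul_apply, tensorKet, Fin.snoc_last, Fin.init_snoc, smul_eq_mul]
      split_ifs <;> simp

end IsOpenData

namespace IsBoundaryData

theorem bdryQ_ne_zero (hbdry : IsBoundaryData N P n V Y S Yt YB YBt)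
    (hopen : IsOpenData N P n V Y) (hv : P.v ≠ 0) (hkappa : P.kappa ≠ 0) (γ σ : Fin n → ZMod N) :
    bdryQ P V S Yt YB YBt γ σ ≠ 0 := by
  refine mul_ne_zero (mul_ne_zero ?_ ?_) ?_
  · exact Finset.prod_ne_zero_iff.mpr fun r _ => omegaPow_ne_zero _
  · exact Finset.prod_ne_zero_iff.mpr fun k _ => Finset.prod_ne_zero_iff.mpr fun r _ =>
      mul_ne_zero (fermatW_ne_zero (hbdry.pointB r k) _) (fermatW_ne_zero (hbdry.pointBT r k) _)
  · refine Finset.prod_ne_zero_iff.mpr fun r _ => Finset.prod_ne_zero_iff.mpr fun s hs => ?_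
    have hrs : r ≠ s := (Finset.mem_filter.mp hs).2.ne
    refine div_ne_zero (fun h => hopen.ampl_ne hv hkappa le_rfl γ γ hrs ?_)
      (fermatW_ne_zero (hbdry.pointT r s hrs) _)
    rw [ampl, ampl]
    linear_combination P.kappa * h

theorem Psi_ne_zero (hbdry : IsBoundaryData N P n V Y S Yt YB YBt)
    (hopen : IsOpenData N P n V Y) (hu : P.u ≠ 0) (hv : P.v ≠ 0) (hkappa : P.kappa ≠ 0)
    (σ : Fin n → ZMod N) : Psi P V Y S Yt YB YBt σ ≠ 0 := fun h =>
  hbdry.bdryQ_ne_zero hopen hv hkappa 0 σ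
    (Fintype.linearIndependent_iff.mp (hopen.linearIndependent_ket hu hv hkappa le_rfl) _ h 0)

end IsBoundaryData

end Basis

/-! ### The one-boundary Hamiltonians -/

section Hamiltonians

open Polynomial

variable {N : ℕ} [NeZero N] {P : Params} {n : ℕ}
  {V : (m : ℕ) → Fin m → ℂ} {Y : (m : ℕ) → Fin m → (m' : ℕ) → Fin m' → ℂ}

theorem eval_eq_sum_fin {p : ℂ[X]} (hp : p.degree < n) (z : ℂ) :
    p.eval z = ∑ j : Fin n, z ^ (n - 1 - (j : ℕ)) * p.coeff (n - 1 - j) := by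
  rcases eq_or_ne p 0 with rfl | h0
  · rw [eval_zero, eq_comm]
    exact Finset.sum_eq_zero fun j _ => by rw [coeff_zero, mul_zero]
  · rw [eval_eq_sum_range' ((natDegree_lt_iff_degree_lt h0).mpr hp), ← Finset.sum_range_reflect,
      Fin.sum_univ_eq_sum_range (fun j => z ^ (n - 1 - j) * p.coeff (n - 1 - j))]
    exact Finset.sum_congr rfl fun j _ => mul_comm _ _

/-- Every z has the form λ + c/λ with λ ≠ 0. The excluded case λ² = θ forces θz² = (θ + c)², so
multiplying by θX² - (θ + c)² gives a polynomial that vanishes everywhere. -/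
theorem eq_zero_of_sum_pow_mul_eq_zero {c θ : ℂ} (hc : c ≠ 0) (hθ : θ ≠ 0) {w : Fin n → ℂ}
    (h : ∀ lam : ℂ, lam ≠ 0 → lam ^ 2 ≠ θ →
      ∑ j : Fin n, (lam + c / lam) ^ (n - 1 - (j : ℕ)) * w j = 0) : w = 0 := by
  set p : ℂ[X] := ∑ j : Fin n, C (w j) * X ^ (n - 1 - (j : ℕ)) with hp
  have he (z : ℂ) : p.eval z = ∑ j : Fin n, z ^ (n - 1 - (j : ℕ)) * w j := by
    rw [hp, eval_finsetSum]
    exact Finset.sum_congr rfl fun j _ => by rw [eval_mul, eval_C, eval_pow, eval_X, mul_comm]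
  have hp0 : p * (C θ * X ^ 2 - C ((θ + c) ^ 2)) = 0 := by
    refine Polynomial.funext fun z => ?_
    rw [eval_mul, eval_zero]
    obtain ⟨s, hs⟩ := IsAlgClosed.exists_pow_nat_eq (z ^ 2 - 4 * c) (n := 2) two_pos
    set lam := (z + s) / 2 with hlam
    have hq : lam ^ 2 + c = z * lam := by rw [hlam]; linear_combination hs / 4
    have hl : lam ≠ 0 := by
      intro h0
      rw [h0] at hq
      exact hc (by linear_combination hq)
    by_cases hl2 : lam ^ 2 = θ
    · have : eval z (C θ * X ^ 2 - C ((θ + c) ^ 2)) = 0 := by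
        simp only [eval_sub, eval_mul, eval_C, eval_pow, eval_X]
        rw [hl2] at hq
        rw [hq, ← hl2]
        ring
      rw [this, mul_zero]
    · have hz : z = lam + c / lam := by
        field_simp
        linear_combination -hq
      rw [he, hz, h lam hl hl2, zero_mul]
  have hq0 : (C θ * X ^ 2 - C ((θ + c) ^ 2) : ℂ[X]) ≠ 0 := by
    intro h0
    have := congrArg (fun q => coeff q 2) h0
    simp only [coeff_sub, coeff_C_mul, coeff_X_pow, coeff_C, coeff_zero] at this
    exact hθ (by simpa using this)
  have hp1 : p = 0 := (mul_eq_zero.mp hp0).resolve_right hq0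
  funext j
  have h1 := congrArg (fun q => coeff q (n - 1 - (j : ℕ))) hp1
  simp only [hp, finsetSum_coeff, coeff_C_mul, coeff_X_pow, coeff_zero] at h1
  rw [Finset.sum_eq_single j] at h1
  · simpa using h1
  · intro i _ hij
    have : (n - 1 - (j : ℕ)) ≠ n - 1 - (i : ℕ) := by
      have := i.is_lt
      have := j.is_lt
      have := Fin.val_ne_of_ne hij
      omega
    simp [this]
  · simp

theorem prod_sub_eq_sum_esymm (a : Fin n → ℂ) (z : ℂ) :
    ∏ k, (z - a k) = z ^ n + ∑ j : Fin n, z ^ (n - 1 - (j : ℕ))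
      * ((-1) ^ ((j : ℕ) + 1) * ∑ t ∈ Finset.univ.powersetCard ((j : ℕ) + 1), ∏ k ∈ t, a k) := by
  have h := congrArg (eval z) (Multiset.prod_X_sub_X_eq_sum_esymm (Finset.univ.val.map a))
  rw [Multiset.map_map] at h
  have h1 : eval z (Multiset.map ((fun t => X - C t) ∘ a) Finset.univ.val).prod
      = ∏ k, (z - a k) := by
    change eval z (∏ k, (X - C (a k))) = _
    simp [eval_prod]
  rw [h1, eval_finsetSum] at h
  simp only [Multiset.card_map, Finset.card_val, Finset.card_univ, Fintype.card_fin,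
    Finset.esymm_map_val] at h
  rw [h, Finset.sum_range_succ', add_comm,
    Fin.sum_univ_eq_sum_range (fun j => z ^ (n - 1 - j) * ((-1) ^ (j + 1)
      * ∑ t ∈ Finset.univ.powersetCard (j + 1), ∏ k ∈ t, a k))]
  congr 1
  · simp
  · refine Finset.sum_congr rfl fun j _ => ?_
    rw [show n - (j + 1) = n - 1 - j by omega, eval_mul, eval_mul, eval_C,
      eval_pow, eval_pow, eval_neg, eval_one, eval_X]
    ring

theorem IsHamiltonians.unique (hkappa : P.kappa ≠ 0) (htheta : P.theta ≠ 0) (halpha : P.alpha ≠ 0)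
    {H H' : Fin n → Module.End ℂ (State N n)} (h : IsHamiltonians P N n H)
    (h' : IsHamiltonians P N n H') : H = H' := by
  have hc : omega N * P.theta ≠ 0 := mul_ne_zero (omega_ne_zero N) htheta
  have key (ψ : State N n) (γ : Fin n → ZMod N) :
      (fun j => H j ψ γ - H' j ψ γ) = 0 := by
    refine eq_zero_of_sum_pow_mul_eq_zero hc htheta fun lam hl hl2 => ?_
    have h1 := (h lam hl hl2).symm.trans (h' lam hl hl2)
    have h2 := add_left_cancel
      (smul_right_injective _ (mul_ne_zero halpha (pow_ne_zero n hkappa)) h1)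
    have h3 := congrFun (LinearMap.congr_fun h2 ψ) γ
    simp only [LinearMap.sum_apply, LinearMap.smul_apply, Finset.sum_apply, Pi.smul_apply,
      smul_eq_mul] at h3
    simp only [mul_sub, Finset.sum_sub_distrib]
    exact sub_eq_zero.mpr h3
  funext j
  refine LinearMap.ext fun ψ => funext fun γ => sub_eq_zero.mp (congrFun (key ψ γ) j)

/-- In the basis |γ⟩ the coefficients of Ã(λ) are polynomials in z: the diagonal one is α₋ϰⁿ times a
monic polynomial of degree n, the others have degree below n. Each Hamiltonian is defined on the
basis by the matching coefficients. -/
theorem exists_isHamiltonians (hopen : IsOpenData N P n V Y) (hu : P.u ≠ 0) (hv : P.v ≠ 0)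
    (hkappa : P.kappa ≠ 0) (htheta : P.theta ≠ 0) (hbeta : P.beta = 0) (hdelta : P.delta = 0)
    (halpha : P.alpha ≠ 0) : ∃ H : Fin n → Module.End ℂ (State N n), IsHamiltonians P N n H := by
  have hak : P.alpha * P.kappa ^ n ≠ 0 := mul_ne_zero halpha (pow_ne_zero n hkappa)
  have hli := hopen.linearIndependent_ket hu hv hkappa le_rfl
  set b := basisOfLinearIndependentOfCardEqFinrank hli (by simp) with hb
  have hbk (γ : Fin n → ZMod N) : b γ = ket V Y n γ := by simp [hb]
  set p : (Fin n → ZMod N) → ℂ[X] := fun γ => ∏ s, (X - C (zeta P V γ s)) - X ^ n with hp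
  set q : (Fin n → ZMod N) → Fin n → ℂ[X] := fun γ r =>
    ∏ s ∈ Finset.univ.erase r, (X - C (zeta P V γ s)) with hq
  have hpd (γ : Fin n → ZMod N) : (p γ).degree < n :=
    degree_prod_X_sub_C_sub_lt (monic_X_pow n) (degree_X_pow n) _
  have hqd (γ : Fin n → ZMod N) (r : Fin n) : (q γ r).degree < n := by
    rw [hq]
    simp only [degree_prod, degree_X_sub_C, Finset.sum_const, Finset.card_erase_of_mem,
      Finset.mem_univ, Finset.card_univ, Fintype.card_fin, nsmul_one]
    exact_mod_cast Nat.sub_lt r.pos one_pos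
  refine ⟨fun j => b.constr ℂ fun γ => (p γ).coeff (n - 1 - j) • ket V Y n γ
    + ∑ r, ((P.alpha * P.kappa ^ n)⁻¹ * raiseCoef P V Y γ r * (q γ r).coeff (n - 1 - j))
      • ket V Y n (γ + Pi.single r 1), fun lam hl hl2 => b.ext fun γ => ?_⟩
  rw [hbk, hopen.opAt_ket hu hv hkappa htheta hbeta hdelta hl hl2]
  generalize lam + omega N * P.theta / lam = z
  have e1 : ∏ s, (z - zeta P V γ s)
      = z ^ n + ∑ j : Fin n, z ^ (n - 1 - (j : ℕ)) * (p γ).coeff (n - 1 - j) := by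
    rw [← eval_eq_sum_fin (hpd γ)]
    simp [hp, eval_prod]
  have e2 (r : Fin n) : ∏ s ∈ Finset.univ.erase r, (z - zeta P V γ s)
      = ∑ j : Fin n, z ^ (n - 1 - (j : ℕ)) * (q γ r).coeff (n - 1 - j) := by
    rw [← eval_eq_sum_fin (hqd γ r)]
    simp [hq, eval_prod]
  have e3 (j : Fin n) := b.constr_basis ℂ (fun γ => (p γ).coeff (n - 1 - j) • ket V Y n γ
    + ∑ r, ((P.alpha * P.kappa ^ n)⁻¹ * raiseCoef P V Y γ r * (q γ r).coeff (n - 1 - j))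
      • ket V Y n (γ + Pi.single r 1)) γ
  simp only [hbk] at e3
  simp only [LinearMap.smul_apply, LinearMap.add_apply, LinearMap.sum_apply, Module.End.one_apply,
    e3, e1, e2, smul_add, Finset.smul_sum, smul_smul, Finset.sum_add_distrib, mul_add, add_smul,
    Finset.mul_sum, Finset.sum_smul, add_assoc]
  congr 2
  · exact Finset.sum_congr rfl fun j _ => by rw [mul_assoc (P.alpha * P.kappa ^ n)]
  · rw [Finset.sum_comm]
    refine Finset.sum_congr rfl fun j _ => Finset.sum_congr rfl fun r _ => ?_
    congr 1
    field_simp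

end Hamiltonians

end RTC

/-! ### Assembly of the eigenvalue equation and the spectrum of the Hamiltonians -/

theorem mainTheorem1 (N : ℕ) [NeZero N] (hN : 2 ≤ N) (n : ℕ) (hn : 1 ≤ n) (P : RTC.Params)
    (hu : P.u ≠ 0) (hv : P.v ≠ 0) (hkappa : P.kappa ≠ 0) (htheta : P.theta ≠ 0)
    (hbeta : P.beta = 0) (hdelta : P.delta = 0)
    (V : (m : ℕ) → Fin m → ℂ) (Y : (m : ℕ) → Fin m → (m' : ℕ) → Fin m' → ℂ)
    (hopen : RTC.IsOpenData N P n V Y)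
    (S : Fin n → ℂ) (Yt YB YBt : Fin n → Fin n → ℂ)
    (hbdry : RTC.IsBoundaryData N P n V Y S Yt YB YBt)
    (σ : Fin n → ZMod N) :
    RTC.Psi P V Y S Yt YB YBt σ ≠ 0 ∧
    (∀ lam : ℂ, lam ≠ 0 → lam ^ 2 ≠ P.theta →
      RTC.opAt P N n lam (RTC.Psi P V Y S Yt YB YBt σ) =
        (P.alpha * (-P.kappa) ^ n *
          ∏ k : Fin n, ((lam - RTC.lamK P S σ k)
            * (RTC.omega N * P.theta / lam - RTC.lamK P S σ k) / RTC.lamK P S σ k))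
          • RTC.Psi P V Y S Yt YB YBt σ) ∧
    (P.alpha ≠ 0 →
      (∃! H : Fin n → Module.End ℂ (RTC.State N n), RTC.IsHamiltonians P N n H) ∧
      ∀ H : Fin n → Module.End ℂ (RTC.State N n), RTC.IsHamiltonians P N n H →
        ∀ j : Fin n, H j (RTC.Psi P V Y S Yt YB YBt σ) =
          ((-1) ^ ((j : ℕ) + 1) * ∑ t ∈ Finset.univ.powersetCard ((j : ℕ) + 1),
            ∏ k ∈ t, (RTC.lamK P S σ k + RTC.omega N * P.theta / RTC.lamK P S σ k))
            • RTC.Psi P V Y S Yt YB YBt σ) := by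
  have hΨ {lam : ℂ} (hl : lam ≠ 0) (hl2 : lam ^ 2 ≠ P.theta) :=
    RTC.opAt_Psi hopen hbdry hu hv hkappa htheta hbeta hdelta σ hl hl2
  refine ⟨hbdry.Psi_ne_zero hopen hu hv hkappa σ, fun lam hl hl2 => ?_, fun halpha => ⟨?_, ?_⟩⟩
  · rw [hΨ hl hl2]
    congr 1
    rw [mul_assoc, mul_assoc]
    congr 1
    -- Factor by factor, (λ - λ_k)(ωθ/λ - λ_k)/λ_k = -(z - z_k), and the signs are absorbed by
    -- (-ϰ)ⁿ.
    rw [show P.kappa ^ n = ∏ _k : Fin n, P.kappa by simp,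
      show (-P.kappa) ^ n = ∏ _k : Fin n, -P.kappa by simp, ← Finset.prod_mul_distrib,
      ← Finset.prod_mul_distrib]
    refine Finset.prod_congr rfl fun k _ => ?_
    have hk : RTC.lamK P S σ k ≠ 0 := by
      rw [RTC.lamK_eq]
      exact neg_ne_zero.mpr (hbdry.amplS_ne_zero hkappa σ k)
    rw [RTC.zK]
    field_simp
    ring
  · obtain ⟨H, hH⟩ :=
      RTC.exists_isHamiltonians hopen hu hv hkappa htheta hbeta hdelta halpha
    exact ⟨H, hH, fun H' hH' => hH'.unique hkappa htheta halpha hH⟩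
  · intro H hH
    have hak : P.alpha * P.kappa ^ n ≠ 0 := mul_ne_zero halpha (pow_ne_zero n hkappa)
    have hc : RTC.omega N * P.theta ≠ 0 := mul_ne_zero (RTC.omega_ne_zero N) htheta
    set Ψ := RTC.Psi P V Y S Yt YB YBt σ with hΨ_def
    set e : Fin n → ℂ := fun j => (-1) ^ ((j : ℕ) + 1)
      * ∑ t ∈ Finset.univ.powersetCard ((j : ℕ) + 1), ∏ k ∈ t, RTC.zK P S σ k with he
    -- Coefficients of powers of z are compared in each component of the vectors, with the
    -- eigenvalue expanded by Vieta's formulas.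
    have key (γ : Fin n → ZMod N) : (fun j => H j Ψ γ - e j * Ψ γ) = 0 := by
      refine RTC.eq_zero_of_sum_pow_mul_eq_zero hc htheta fun lam hl hl2 => ?_
      have h1 := hΨ hl hl2
      rw [hH lam hl hl2, LinearMap.smul_apply, mul_smul (P.alpha * P.kappa ^ n)] at h1
      have h2 := congrFun (smul_right_injective _ hak h1) γ
      rw [RTC.prod_sub_eq_sum_esymm] at h2
      simp only [LinearMap.add_apply, LinearMap.sum_apply, LinearMap.smul_apply, Pi.add_apply,
        Finset.sum_apply, Pi.smul_apply, smul_eq_mul, Module.End.one_apply, add_mul] at h2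
      have h3 := add_left_cancel h2
      simp only [mul_sub, Finset.sum_sub_distrib]
      rw [h3, Finset.sum_mul, sub_eq_zero]
      exact Finset.sum_congr rfl fun j _ => by rw [mul_assoc]
    intro j
    funext γ
    exact sub_eq_zero.mp (congrFun (key γ) j)
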